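/- **Setting.** Two teams with agent sets $\mathcal N^{(1)}=\{1,\dots,K_1\}$ and $\mathcal N^{(2)}=\{K_1+1,\dots,K\}$, $K=K_1+K_2$, use combination matrices $A^{(t)}=(a^{(t)}_{\ell k})\in\mathbb R^{K_t\times K_t}$ that are primitive and left-stochastic (nonnegative entries, columns summing to one). Let $p^{(t)}$ be the Perron vector: $A^{(t)}p^{(t)}=p^{(t)}$, $\mathbb 1^\top p^{(t)}=1$; write $p_k$ for the entry of agent $k$. The inference matrix is $C=(c_{\ell k})=\begin{bmatrix}C^{(1)}&C^{(12)}\\C^{(21)}&C^{(2)}\end{bmatrix}\in\mathbb R^{K\times K}$. It is called * *strong* if $C^{(1)}=0$, $C^{(2)}=0$ and $C^{(12)},C^{(21)}$ are left-stochastic; * *weak* if $C$ is left-stochastic, $C^{(1)},C^{(2)}$ are irreducible (a zero $1\times1$ block not being counted as irreducible), and for each team some agent $k$ of that team and some agent $\ell$ of the other team satisfy $c_{\ell k}>0$. Agent $k$ has a local risk $J_k:\mathbb R^{M_1}\times\mathbb R^{M_2}\to\mathbb R$ whose partial gradients exist, and $J^{(t)}=\sum_{k\in\mathcal N^{(t)}}p_kJ_k$.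 For $w\in\{x,y\}$, all $k\in\mathcal N^{(t)}$ and all points, assume $\|\nabla_wJ_k(x_1,y_1)-\nabla_wJ_k(x_2,y_2)\|\le L_f(\|x_1-x_2\|+\|y_1-y_2\|)$ and $\|\nabla_wJ_k(x,y)-\nabla_wJ^{(t)}(x,y)\|\le G$. **Algorithms.** With step size $\mu>0$, from measurable, square-integrable initial vectors $\boldsymbol x_{k,-1},\boldsymbol y_{k,-1}$ (for instance $0$), put for $i\ge0$, with all stochastic gradients of agent $\ell$ in iteration $i$ sampled at $(\boldsymbol x_{\ell,i-1},\boldsymbol y_{\ell,i-1})$, $$\boldsymbol x_{k,i}=\sum_{\ell\in\mathcal N^{(1)}}a^{(1)}_{\ell k}\bigl(\boldsymbol x_{\ell,i-1}-\mu\widehat{\nabla_xJ}_\ell\bigr)\ (k\in\mathcal N^{(1)}),\qquad \boldsymbol y_{k,i}=\sum_{\ell\in\mathcal N^{(2)}}a^{(2)}_{\ell k}\bigl(\boldsymbol y_{\ell,i-1}-\mu\widehat{\nabla_yJ}_\ell\bigr)\ (k\in\mathcal N^{(2)}).$$ The inferred opponent iterates are, in **ATC-ITC**, $$\boldsymbol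 y_{k,i}=\sum_{\ell\in\mathcal N^{(2)}}c_{\ell k}\boldsymbol y_{\ell,i}+\sum_{\ell\in\mathcal N^{(1)}}c_{\ell k}\bigl(\boldsymbol y_{\ell,i-1}+\mu\widehat{\nabla_yJ}_\ell\bigr)\ (k\in\mathcal N^{(1)}),$$ $$\boldsymbol x_{k,i}=\sum_{\ell\in\mathcal N^{(1)}}c_{\ell k}\boldsymbol x_{\ell,i}+\sum_{\ell\in\mathcal N^{(2)}}c_{\ell k}\bigl(\boldsymbol x_{\ell,i-1}+\mu\widehat{\nabla_xJ}_\ell\bigr)\ (k\in\mathcal N^{(2)}),$$ and, in **ATC-C**, $\boldsymbol y_{k,i}=\sum_{\ell\in\mathcal N^{(2)}}c_{\ell k}\boldsymbol y_{\ell,i}$ $(k\in\mathcal N^{(1)})$, $\boldsymbol x_{k,i}=\sum_{\ell\in\mathcal N^{(1)}}c_{\ell k}\boldsymbol x_{\ell,i}$ $(k\in\mathcal N^{(2)})$. *Gradient noise.* The stochastic gradients are measurable, and, given the $\sigma$-algebra generated by all $(\boldsymbol x_{k,j},\boldsymbol y_{k,j})$, $j\le i-1$, those sampled in iteration $i$ at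 $(\boldsymbol x_{k,i-1},\boldsymbol y_{k,i-1})$ have conditional mean $\nabla_wJ_k(\boldsymbol x_{k,i-1},\boldsymbol y_{k,i-1})$ and an error whose squared norm is integrable with conditional expectation at most $\sigma^2$. Let $\boldsymbol x_{c,i}=\sum_{k\in\mathcal N^{(1)}}p_k\boldsymbol x_{k,i}$, $\boldsymbol y_{c,i}=\sum_{k\in\mathcal N^{(2)}}p_k\boldsymbol y_{k,i}$ be the team centroids, and $$\boldsymbol\Delta_i=\sum_{k\in\mathcal N^{(1)}}\|\boldsymbol x_{k,i}-\boldsymbol x_{c,i}\|^2+\sum_{k\in\mathcal N^{(2)}}\|\boldsymbol y_{k,i}-\boldsymbol y_{c,i}\|^2+\sum_{k\in\mathcal N^{(2)}}\|\boldsymbol x_{k,i}-\boldsymbol x_{c,i}\|^2+\sum_{k\in\mathcal N^{(1)}}\|\boldsymbol y_{k,i}-\boldsymbol y_{c,i}\|^2 .$$ **Lemma (within-team and cross-team consensus).** 1. (ATC-ITC) Let $C$ be weak. There is $\alpha\in(0,1)$, depending only on $A^{(1)},A^{(2)},C$, such that for every $L_f$ there is $\mu_0>0$ such that for all $G,\sigma,D$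 and $\kappa>0$ there is a constant $B$ with the following property. For every zero-sum game ($J^{(1)}=-J^{(2)}$) and every run of ATC-ITC as above, with these constants, $\mathbb E\,\boldsymbol\Delta_{-1}\le D$ and $0<\mu\le\mu_0$, the variable $\boldsymbol\Delta_i$ is integrable and $$\mathbb E\,\boldsymbol\Delta_i\le B\mu^2\qquad\text{for all integers } i\ge 0 \text{ with } i\ge i_\alpha=\frac{\log(\kappa\mu^2)}{\log\alpha}.$$ 2. (ATC-C) Let $C$ be strong. The same holds for every run of ATC-C, without the zero-sum condition, with a constant $\beta\in(0,1)$ depending only on $A^{(1)},A^{(2)},C$ and $i_\beta=\log(\kappa\mu^2)/\log\beta$. -/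

import Mathlib

open MeasureTheory ProbabilityTheory Matrix

/-- The agents of the game: Team 1 is `Fin K₁` (left), Team 2 is `Fin K₂` (right). -/
abbrev Agent (K₁ K₂ : ℕ) : Type := Fin K₁ ⊕ Fin K₂

/-- Strategies of a team: vectors of `ℝ^M` with the Euclidean norm. -/
abbrev Strategy (M : ℕ) : Type := EuclideanSpace ℝ (Fin M)

/-- Left-stochastic (possibly rectangular) matrix: nonnegative entries, every column sums to one. -/
def IsLeftStochastic {m n : Type*} [Fintype m] (A : Matrix m n ℝ) : Prop :=
  (∀ l k, 0 ≤ A l k) ∧ ∀ k, ∑ l, A l k = 1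

/-- Within-team combination matrix: primitive and left-stochastic. -/
def IsCombinationMatrix {K : ℕ} (A : Matrix (Fin K) (Fin K) ℝ) : Prop :=
  A.IsPrimitive ∧ IsLeftStochastic A

/-- `p` is the Perron eigenvector of `A`, normalized so that its entries sum to one. For a primitive
left-stochastic `A` these two conditions determine `p`, and its entries are then positive. -/
def IsPerronVector {K : ℕ} (A : Matrix (Fin K) (Fin K) ℝ) (p : Fin K → ℝ) : Prop :=
  A *ᵥ p = p ∧ ∑ k, p k = 1

/-- Inference matrix for a strong cross-team subgraph: the diagonal blocks vanish and the
off-diagonal blocks are left-stochastic. -/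
def IsStrongInference {K₁ K₂ : ℕ} (C : Matrix (Agent K₁ K₂) (Agent K₁ K₂) ℝ) : Prop :=
  C.toBlocks₁₁ = 0 ∧ C.toBlocks₂₂ = 0 ∧
    IsLeftStochastic C.toBlocks₁₂ ∧ IsLeftStochastic C.toBlocks₂₁

/-- Inference matrix for a weak cross-team subgraph: left-stochastic, with irreducible diagonal
blocks and at least one positive weight across the teams in each direction. -/
def IsWeakInference {K₁ K₂ : ℕ} (C : Matrix (Agent K₁ K₂) (Agent K₁ K₂) ℝ) : Prop :=
  IsLeftStochastic C ∧ C.toBlocks₁₁.IsIrreducible ∧ C.toBlocks₂₂.IsIrreducible ∧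
    (∃ (k : Fin K₁) (l : Fin K₂), 0 < C (Sum.inr l) (Sum.inl k)) ∧
    (∃ (k : Fin K₂) (l : Fin K₁), 0 < C (Sum.inl l) (Sum.inr k))

section Costs

variable {K₁ K₂ M₁ M₂ : ℕ}

/-- Partial gradient in `x` of a cost `f (x, y)`. -/
noncomputable def gradX (f : Strategy M₁ → Strategy M₂ → ℝ) (x : Strategy M₁) (y : Strategy M₂) :
    Strategy M₁ :=
  gradient (fun u => f u y) x

/-- Partial gradient in `y` of a cost `f (x, y)`. -/
noncomputable def gradY (f : Strategy M₁ → Strategy M₂ → ℝ) (x : Strategy M₁) (y : Strategy M₂) :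
    Strategy M₂ :=
  gradient (fun v => f x v) y

/-- Global risk of Team 1. -/
def teamCost₁ (p₁ : Fin K₁ → ℝ) (J : Agent K₁ K₂ → Strategy M₁ → Strategy M₂ → ℝ)
    (x : Strategy M₁) (y : Strategy M₂) : ℝ :=
  ∑ k : Fin K₁, p₁ k * J (Sum.inl k) x y

/-- Global risk of Team 2. -/
def teamCost₂ (p₂ : Fin K₂ → ℝ) (J : Agent K₁ K₂ → Strategy M₁ → Strategy M₂ → ℝ)
    (x : Strategy M₁) (y : Strategy M₂) : ℝ :=
  ∑ k : Fin K₂, p₂ k * J (Sum.inr k) x y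

/-- Zero-sum objectives. -/
def IsZeroSum (p₁ : Fin K₁ → ℝ) (p₂ : Fin K₂ → ℝ)
    (J : Agent K₁ K₂ → Strategy M₁ → Strategy M₂ → ℝ) : Prop :=
  ∀ x y, teamCost₁ p₁ J x y = -teamCost₂ p₂ J x y

/-- Every local risk has partial gradients, and these are `Lf`-Lipschitz. -/
structure LipschitzGradients (J : Agent K₁ K₂ → Strategy M₁ → Strategy M₂ → ℝ) (Lf : ℝ) :
    Prop where
  diffX : ∀ k y, Differentiable ℝ (fun x => J k x y)
  diffY : ∀ k x, Differentiable ℝ (fun y => J k x y)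
  lipX : ∀ k x₁ y₁ x₂ y₂,
    ‖gradX (J k) x₁ y₁ - gradX (J k) x₂ y₂‖ ≤ Lf * (‖x₁ - x₂‖ + ‖y₁ - y₂‖)
  lipY : ∀ k x₁ y₁ x₂ y₂,
    ‖gradY (J k) x₁ y₁ - gradY (J k) x₂ y₂‖ ≤ Lf * (‖x₁ - x₂‖ + ‖y₁ - y₂‖)

/-- The gradients of the local risks stay within `G` of those of their own team's global risk. -/
structure BoundedDisagreement (p₁ : Fin K₁ → ℝ) (p₂ : Fin K₂ → ℝ)
    (J : Agent K₁ K₂ → Strategy M₁ → Strategy M₂ → ℝ) (G : ℝ) : Prop where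
  team₁X : ∀ (k : Fin K₁) x y, ‖gradX (J (Sum.inl k)) x y - gradX (teamCost₁ p₁ J) x y‖ ≤ G
  team₁Y : ∀ (k : Fin K₁) x y, ‖gradY (J (Sum.inl k)) x y - gradY (teamCost₁ p₁ J) x y‖ ≤ G
  team₂X : ∀ (k : Fin K₂) x y, ‖gradX (J (Sum.inr k)) x y - gradX (teamCost₂ p₂ J) x y‖ ≤ G
  team₂Y : ∀ (k : Fin K₂) x y, ‖gradY (J (Sum.inr k)) x y - gradY (teamCost₂ p₂ J) x y‖ ≤ G

end Costs

/-- A pair `(x_k, y_k)` for every agent `k`. For an agent of Team 1, `x k` is its own strategy and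
`y k` its inferred opponent strategy; for an agent of Team 2 the roles are exchanged. -/
structure Profile (K₁ K₂ M₁ M₂ : ℕ) where
  x : Agent K₁ K₂ → Strategy M₁
  y : Agent K₁ K₂ → Strategy M₂

/-- Stochastic gradients: `gx n k x y ω` is the sample of the `x`-gradient of agent `k` at `(x, y)`
used in passing from the `n`-th profile to the next one; similarly `gy`. -/
structure StochasticGradients (Ω : Type*) (K₁ K₂ M₁ M₂ : ℕ) where
  gx : ℕ → Agent K₁ K₂ → Strategy M₁ → Strategy M₂ → Ω → Strategy M₁
  gy : ℕ → Agent K₁ K₂ → Strategy M₁ → Strategy M₂ → Ω → Strategy M₂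

section Algorithms

variable {K₁ K₂ M₁ M₂ : ℕ}

/-- Within-team adapt-then-combine step of Team 1. -/
noncomputable def adaptCombineX (A₁ : Matrix (Fin K₁) (Fin K₁) ℝ) (μ : ℝ)
    (z g : Profile K₁ K₂ M₁ M₂) (k : Fin K₁) : Strategy M₁ :=
  ∑ l : Fin K₁, A₁ l k • (z.x (Sum.inl l) - μ • g.x (Sum.inl l))

/-- Within-team adapt-then-combine step of Team 2. -/
noncomputable def adaptCombineY (A₂ : Matrix (Fin K₂) (Fin K₂) ℝ) (μ : ℝ)
    (z g : Profile K₁ K₂ M₁ M₂) (k : Fin K₂) : Strategy M₂ :=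
  ∑ l : Fin K₂, A₂ l k • (z.y (Sum.inr l) - μ • g.y (Sum.inr l))

/-- One iteration of ATC-ITC from the profile `z`, where `g` holds the stochastic gradients sampled
by the agents. In the inference step each agent moves its estimate of the opponent's strategy along
`+μ` times its own gradient. -/
noncomputable def atcItcStep (A₁ : Matrix (Fin K₁) (Fin K₁) ℝ) (A₂ : Matrix (Fin K₂) (Fin K₂) ℝ)
    (C : Matrix (Agent K₁ K₂) (Agent K₁ K₂) ℝ) (μ : ℝ) (z g : Profile K₁ K₂ M₁ M₂) :
    Profile K₁ K₂ M₁ M₂ where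
  x := Sum.elim (adaptCombineX A₁ μ z g) fun k =>
    ∑ l : Fin K₁, C (Sum.inl l) (Sum.inr k) • adaptCombineX A₁ μ z g l +
      ∑ l : Fin K₂, C (Sum.inr l) (Sum.inr k) • (z.x (Sum.inr l) + μ • g.x (Sum.inr l))
  y := Sum.elim
    (fun k =>
      ∑ l : Fin K₂, C (Sum.inr l) (Sum.inl k) • adaptCombineY A₂ μ z g l +
        ∑ l : Fin K₁, C (Sum.inl l) (Sum.inl k) • (z.y (Sum.inl l) + μ • g.y (Sum.inl l)))
    (adaptCombineY A₂ μ z g)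

/-- One iteration of ATC-C: the opponent's strategy is inferred by combining the new strategies of
the neighbouring opponents. -/
noncomputable def atcCStep (A₁ : Matrix (Fin K₁) (Fin K₁) ℝ) (A₂ : Matrix (Fin K₂) (Fin K₂) ℝ)
    (C : Matrix (Agent K₁ K₂) (Agent K₁ K₂) ℝ) (μ : ℝ) (z g : Profile K₁ K₂ M₁ M₂) :
    Profile K₁ K₂ M₁ M₂ where
  x := Sum.elim (adaptCombineX A₁ μ z g) fun k =>
    ∑ l : Fin K₁, C (Sum.inl l) (Sum.inr k) • adaptCombineX A₁ μ z g l
  y := Sum.elim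
    (fun k => ∑ l : Fin K₂, C (Sum.inr l) (Sum.inl k) • adaptCombineY A₂ μ z g l)
    (adaptCombineY A₂ μ z g)

/-- The random profiles generated by a one-step rule. The profile with index `0` is the
initialization (time `-1`), so that the profile with index `i + 1` is the one of time `i`. -/
def iterates {Ω : Type*}
    (step : Profile K₁ K₂ M₁ M₂ → Profile K₁ K₂ M₁ M₂ → Profile K₁ K₂ M₁ M₂)
    (S : StochasticGradients Ω K₁ K₂ M₁ M₂) (z₀ : Ω → Profile K₁ K₂ M₁ M₂) :
    ℕ → Ω → Profile K₁ K₂ M₁ M₂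
  | 0 => z₀
  | n + 1 => fun ω =>
      let z := iterates step S z₀ n ω
      step z ⟨fun k => S.gx n k (z.x k) (z.y k) ω, fun k => S.gy n k (z.x k) (z.y k) ω⟩

/-- The σ-algebra generated by all agents' pairs `(x_k, y_k)` up to index `n`. -/
def history {Ω : Type*} (Z : ℕ → Ω → Profile K₁ K₂ M₁ M₂) (n : ℕ) : MeasurableSpace Ω :=
  ⨆ (j : ℕ) (_ : j ≤ n) (k : Agent K₁ K₂),
    MeasurableSpace.comap (fun ω => (Z j ω).x k) inferInstance ⊔
      MeasurableSpace.comap (fun ω => (Z j ω).y k) inferInstance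

/-- Gradient noise process: the stochastic gradients are measurable and, at the pairs
`(x_k, y_k)` at which the algorithm queries them, unbiased with variance at most `σ²`, conditionally
on the past. -/
structure GradientNoise {Ω : Type*} [MeasurableSpace Ω] (P : Measure Ω)
    (J : Agent K₁ K₂ → Strategy M₁ → Strategy M₂ → ℝ) (S : StochasticGradients Ω K₁ K₂ M₁ M₂)
    (Z : ℕ → Ω → Profile K₁ K₂ M₁ M₂) (σ : ℝ) : Prop where
  measX : ∀ n k, Measurable fun q : Strategy M₁ × Strategy M₂ × Ω => S.gx n k q.1 q.2.1 q.2.2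
  measY : ∀ n k, Measurable fun q : Strategy M₁ × Strategy M₂ × Ω => S.gy n k q.1 q.2.1 q.2.2
  unbiasedX : ∀ n k, P[fun ω => S.gx n k ((Z n ω).x k) ((Z n ω).y k) ω | history Z n]
    =ᵐ[P] fun ω => gradX (J k) ((Z n ω).x k) ((Z n ω).y k)
  unbiasedY : ∀ n k, P[fun ω => S.gy n k ((Z n ω).x k) ((Z n ω).y k) ω | history Z n]
    =ᵐ[P] fun ω => gradY (J k) ((Z n ω).x k) ((Z n ω).y k)
  integrableX : ∀ n k, Integrable (fun ω => ‖S.gx n k ((Z n ω).x k) ((Z n ω).y k) ω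
    - gradX (J k) ((Z n ω).x k) ((Z n ω).y k)‖ ^ 2) P
  integrableY : ∀ n k, Integrable (fun ω => ‖S.gy n k ((Z n ω).x k) ((Z n ω).y k) ω
    - gradY (J k) ((Z n ω).x k) ((Z n ω).y k)‖ ^ 2) P
  varianceX : ∀ n k, P[fun ω => ‖S.gx n k ((Z n ω).x k) ((Z n ω).y k) ω
    - gradX (J k) ((Z n ω).x k) ((Z n ω).y k)‖ ^ 2 | history Z n] ≤ᵐ[P] fun _ => σ ^ 2
  varianceY : ∀ n k, P[fun ω => ‖S.gy n k ((Z n ω).x k) ((Z n ω).y k) ω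
    - gradY (J k) ((Z n ω).x k) ((Z n ω).y k)‖ ^ 2 | history Z n] ≤ᵐ[P] fun _ => σ ^ 2

/-- Measurable, square-integrable random initialization (in particular the zero one). -/
structure SquareIntegrableInit {Ω : Type*} [MeasurableSpace Ω] (P : Measure Ω)
    (z₀ : Ω → Profile K₁ K₂ M₁ M₂) : Prop where
  measX : ∀ k, Measurable fun ω => (z₀ ω).x k
  measY : ∀ k, Measurable fun ω => (z₀ ω).y k
  memLpX : ∀ k, MemLp (fun ω => (z₀ ω).x k) 2 P
  memLpY : ∀ k, MemLp (fun ω => (z₀ ω).y k) 2 P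

/-- Centroid of Team 1: the Perron-weighted average of its agents' own strategies. -/
noncomputable def centroidX (p₁ : Fin K₁ → ℝ) (z : Profile K₁ K₂ M₁ M₂) : Strategy M₁ :=
  ∑ k : Fin K₁, p₁ k • z.x (Sum.inl k)

/-- Centroid of Team 2: the Perron-weighted average of its agents' own strategies. -/
noncomputable def centroidY (p₂ : Fin K₂ → ℝ) (z : Profile K₁ K₂ M₁ M₂) : Strategy M₂ :=
  ∑ k : Fin K₂, p₂ k • z.y (Sum.inr k)

/-- Total squared deviation: Team 1's and Team 2's own strategies from their own centroids, then
Team 2's and Team 1's inferred strategies from the opponent's centroid. -/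
noncomputable def deviation (p₁ : Fin K₁ → ℝ) (p₂ : Fin K₂ → ℝ) (z : Profile K₁ K₂ M₁ M₂) : ℝ :=
  ∑ k : Fin K₁, ‖z.x (Sum.inl k) - centroidX p₁ z‖ ^ 2 +
    ∑ k : Fin K₂, ‖z.y (Sum.inr k) - centroidY p₂ z‖ ^ 2 +
    ∑ k : Fin K₂, ‖z.x (Sum.inr k) - centroidX p₁ z‖ ^ 2 +
    ∑ k : Fin K₁, ‖z.y (Sum.inl k) - centroidY p₂ z‖ ^ 2

end Algorithms

/-! ### Matrices whose powers tend to zero. -/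

section Matrices

variable {ι : Type*} [Fintype ι]

/-! Measured from the team centroid, each strategy obeys a block-triangular linear recursion: the
own copies `u` are combined by `A - p 𝟙ᵀ`, and the inferred copies `v` by a diagonal block `Q` of
`C`, with an input from the new `u`. Both matrices have powers tending to zero. For `A - p 𝟙ᵀ` this
is Doeblin contraction (`hasSmallPower_deflation`). For `Q` in the weak case, irreducibility carries
the mass missing from one column to every column (`hasSmallPower_of_substochastic`); in the strong
case `Q = 0`. A norm adapted to each matrix makes it a strict contraction, and a large weight on `u`
absorbs the coupling (`exists_stepGauge`).

The perturbation is small because a common displacement of all copies is invisible in the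
deviations. At the centroids the agents of the team owning the strategy have gradients within `G` of
one vector `γ`; in a zero-sum game those of the opponents are within `G` of `-γ`. The own step `-μ`
and the inference step `+μ` therefore both displace by about `-μγ`. What remains is `μ` times noise,
`G`, and `Lf` times the distance from consensus. When the diagonal blocks vanish, the opponents'
gradients do not enter and the zero-sum condition is not needed (`IsProfileGauge.atcItcStep_le`).

A small `μ` absorbs the `Lf` term into the contraction. Squaring by convexity and taking
expectations gives a geometrically decaying transient plus `O(μ²)` (`integral_sq_le_of_recursion`),
and the logarithmic waiting time makes the transient `O(μ²)` too. The rate `ρ = (1 + r) / 2` is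
fixed before `Lf` is given; only `μ₀` depends on `Lf`. -/

theorem colSum_mul (X Y : Matrix ι ι ℝ) (k : ι) :
    ∑ l, (X * Y) l k = ∑ m, (∑ l, X l m) * Y m k := by
  simp only [Matrix.mul_apply, Finset.sum_mul]
  exact Finset.sum_comm

/-- The deflation of a left-stochastic matrix by its Perron vector. -/
def deflation (A : Matrix ι ι ℝ) (p : ι → ℝ) : Matrix ι ι ℝ := fun l k => A l k - p l

theorem colSum_deflation {A : Matrix ι ι ℝ} {p : ι → ℝ} (hA : ∀ k, ∑ l, A l k = 1)
    (hp : ∑ l, p l = 1) (k : ι) : ∑ l, deflation A p l k = 0 := by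
  simp [deflation, hA, hp]

/-- Doeblin contraction: a left-stochastic matrix with entries at least `δ` contracts the
`ℓ¹`-norm of vectors of zero sum. -/
theorem sum_abs_mulVec_le {B : Matrix ι ι ℝ} (hB : IsLeftStochastic B) {δ : ℝ}
    (hδ : ∀ l k, δ ≤ B l k) {v : ι → ℝ} (hv : ∑ l, v l = 0) :
    ∑ l, |(B *ᵥ v) l| ≤ (1 - Fintype.card ι * δ) * ∑ l, |v l| := by
  have h1 : ∀ l, (B *ᵥ v) l = ∑ m, (B l m - δ) * v m := fun l => by
    simp only [Matrix.mulVec, dotProduct, sub_mul, Finset.sum_sub_distrib, ← Finset.mul_sum, hv,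
      mul_zero, sub_zero]
  calc ∑ l, |(B *ᵥ v) l| ≤ ∑ l, ∑ m, (B l m - δ) * |v m| := by
        refine Finset.sum_le_sum fun l _ => ?_
        rw [h1]
        refine (Finset.abs_sum_le_sum_abs _ _).trans (le_of_eq ?_)
        refine Finset.sum_congr rfl fun m _ => ?_
        rw [abs_mul, abs_of_nonneg (sub_nonneg.2 (hδ l m))]
    _ = (1 - Fintype.card ι * δ) * ∑ l, |v l| := by
        rw [Finset.sum_comm, Finset.mul_sum]
        refine Finset.sum_congr rfl fun m _ => ?_
        rw [← Finset.sum_mul, Finset.sum_sub_distrib, hB.2]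
        simp

variable [DecidableEq ι]

/-- Some positive power of `T` has entries of total absolute value at most one half. -/
def HasSmallPower (T : Matrix ι ι ℝ) : Prop :=
  ∃ N, 0 < N ∧ ∑ l, ∑ k, |(T ^ N) l k| ≤ 1 / 2

/-- The exponent is `m * (j + 1)` because the zeroth power of a deflation lacks the zero column sums
on which its contraction rests; `S` carries the size of the first block. -/
theorem hasSmallPower_of_geometric {T : Matrix ι ι ℝ} {m : ℕ} (hm : 0 < m) {r : ℝ}
    (hr0 : 0 ≤ r) (hr1 : r < 1) {S : ι → ℝ}
    (h : ∀ j k, ∑ l, |(T ^ (m * (j + 1))) l k| ≤ r ^ j * S k) : HasSmallPower T := by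
  have hlim : Filter.Tendsto (fun j : ℕ => r ^ j * ∑ k, S k) Filter.atTop (nhds 0) := by
    simpa using (tendsto_pow_atTop_nhds_zero_of_lt_one hr0 hr1).mul_const (∑ k, S k)
  obtain ⟨j, hj⟩ := (hlim.eventually_le_const (by norm_num : (0 : ℝ) < 1 / 2)).exists
  refine ⟨m * (j + 1), by positivity, ?_⟩
  rw [Finset.sum_comm]
  refine le_trans (Finset.sum_le_sum fun k _ => h j k) ?_
  rwa [← Finset.mul_sum]

theorem IsLeftStochastic.pow {A : Matrix ι ι ℝ} (hA : IsLeftStochastic A) (n : ℕ) :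
    IsLeftStochastic (A ^ n) := by
  induction n with
  | zero =>
    refine ⟨fun l k => ?_, fun k => by simp [Matrix.one_apply]⟩
    rw [pow_zero, Matrix.one_apply]; split_ifs <;> norm_num
  | succ n ih =>
    refine ⟨fun l k => ?_, fun k => ?_⟩
    · rw [pow_succ, Matrix.mul_apply]
      exact Finset.sum_nonneg fun m _ => mul_nonneg (ih.1 _ _) (hA.1 _ _)
    · rw [pow_succ, colSum_mul]
      simp [ih.2, hA.2]

theorem mulVec_pow_eq {A : Matrix ι ι ℝ} {p : ι → ℝ} (h : A *ᵥ p = p) (n : ℕ) :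
    (A ^ n) *ᵥ p = p := by
  induction n with
  | zero => simp
  | succ n ih => rw [pow_succ, ← Matrix.mulVec_mulVec, h, ih]

/-- Since `A p = p`, `𝟙ᵀ A = 𝟙ᵀ` and `𝟙ᵀ p = 1`, the cross terms in `(A - p 𝟙ᵀ)ⁿ` collapse. Exponent
zero is excluded: the identity is not its own deflation. -/
theorem deflation_pow {A : Matrix ι ι ℝ} {p : ι → ℝ} (hA : ∀ k, ∑ l, A l k = 1)
    (h : A *ᵥ p = p) (hp : ∑ l, p l = 1) (n : ℕ) :
    deflation A p ^ (n + 1) = deflation (A ^ (n + 1)) p := by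
  induction n with
  | zero => simp
  | succ n ih =>
    have key : ∀ l, ∑ m, (A ^ (n + 1)) l m * p m = p l := fun l =>
      congrFun (mulVec_pow_eq h (n + 1)) l
    rw [pow_succ, ih]
    ext l k
    rw [Matrix.mul_apply]
    simp only [deflation, sub_mul, mul_sub, Finset.sum_sub_distrib, ← Finset.mul_sum, hA, hp,
      key, pow_succ A (n + 1), Matrix.mul_apply]
    simp only [mul_one, sub_self, sub_zero]

/-- Columns of positive powers of the deflation have zero sum, and on zero-sum vectors `A ^ (m + 1)
- p 𝟙ᵀ` acts as the positive stochastic matrix `A ^ (m + 1)`, which contracts by Doeblin with `δ`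
its smallest entry. -/
theorem hasSmallPower_deflation {A : Matrix ι ι ℝ} {p : ι → ℝ} (hprim : A.IsPrimitive)
    (hA : IsLeftStochastic A) (h : A *ᵥ p = p) (hp : ∑ l, p l = 1) :
    HasSmallPower (deflation A p) := by
  obtain ⟨m, hm, hpos⟩ := hprim.exists_pos_pow
  obtain ⟨m, rfl⟩ : ∃ n, m = n + 1 := ⟨m - 1, by omega⟩
  have hne : Nonempty ι := by
    by_contra hemp
    rw [not_nonempty_iff] at hemp
    simp at hp
  obtain ⟨q, hq⟩ := Finite.exists_min fun q : ι × ι => (A ^ (m + 1)) q.1 q.2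
  set δ := (A ^ (m + 1)) q.1 q.2 with hδdef
  have hδ : 0 < δ := hpos _ _
  have hB := hA.pow (m + 1)
  have hle : ∀ l k, δ ≤ (A ^ (m + 1)) l k := fun l k => hq (l, k)
  have hcard : (Fintype.card ι : ℝ) * δ ≤ 1 := by
    rw [← hB.2 q.1]
    calc (Fintype.card ι : ℝ) * δ = ∑ _l : ι, δ := by simp
      _ ≤ _ := Finset.sum_le_sum fun l _ => hle l _
  have hcard0 : 0 < (Fintype.card ι : ℝ) := by exact_mod_cast Fintype.card_pos
  have hzero : ∀ n k, ∑ l, (deflation A p ^ (n + 1)) l k = 0 := fun n k => by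
    rw [deflation_pow hA.2 h hp]
    exact colSum_deflation (hA.pow _).2 hp k
  refine hasSmallPower_of_geometric (m := m + 1) (r := 1 - Fintype.card ι * δ)
    (S := fun k => ∑ l, |(deflation A p ^ (m + 1)) l k|) (by omega) (by linarith)
    (by nlinarith) ?_
  intro j k
  induction j with
  | zero => simp
  | succ j ih =>
    have hz : ∑ l, (deflation A p ^ ((m + 1) * (j + 1))) l k = 0 := by
      have := hzero ((m + 1) * (j + 1) - 1) k
      rwa [Nat.sub_add_cancel (Nat.mul_pos m.succ_pos j.succ_pos)] at this
    have hexp : ∀ l, (deflation A p ^ ((m + 1) * (j + 1 + 1))) l k =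
        ((A ^ (m + 1)) *ᵥ fun i => (deflation A p ^ ((m + 1) * (j + 1))) i k) l := fun l => by
      rw [mul_add (m + 1) (j + 1) 1, mul_one, add_comm _ (m + 1), pow_add,
        deflation_pow hA.2 h hp m, Matrix.mul_apply]
      simp only [deflation, sub_mul, Finset.sum_sub_distrib, ← Finset.mul_sum]
      rw [show ∑ i, (deflation A p ^ ((m + 1) * (j + 1))) i k = 0 from hz]
      simp [Matrix.mulVec, dotProduct]
    simp only [hexp]
    refine (sum_abs_mulVec_le hB hle hz).trans ?_
    rw [pow_succ', mul_assoc]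
    exact mul_le_mul_of_nonneg_left ih (by linarith)

/-- An irreducible matrix with column sums at most one, one of them less than one, has powers
tending to zero. -/
theorem hasSmallPower_of_substochastic {Q : Matrix ι ι ℝ} (hQ : Q.IsIrreducible)
    (hle : ∀ k, ∑ l, Q l k ≤ 1) {k₀ : ι} (hlt : ∑ l, Q l k₀ < 1) : HasSmallPower Q := by
  have hnn : ∀ n l k, 0 ≤ (Q ^ n) l k := fun n l k => Matrix.pow_apply_nonneg hQ.nonneg n l k
  set s : ℕ → ι → ℝ := fun n k => ∑ l, (Q ^ n) l k with hs
  have hrec : ∀ n k, s (n + 1) k = ∑ m, (∑ l, Q l m) * (Q ^ n) m k := fun n k => by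
    simp only [hs, pow_succ', colSum_mul]
  have hanti : ∀ k, Antitone fun n => s n k := fun k => antitone_nat_of_succ_le fun n => by
    rw [hrec]
    exact Finset.sum_le_sum fun m _ => mul_le_of_le_one_left (hnn _ _ _) (hle m)
  have hs1 : ∀ n k, s n k ≤ 1 := fun n k => (hanti k (Nat.zero_le n)).trans
    (by simp [hs, Matrix.one_apply])
  -- A path of positive weight joins column `k` to the deficient column `k₀`, so one further
  -- multiplication by `Q` loses mass.
  have hex : ∀ k, ∃ n, s n k < 1 := fun k => by
    obtain ⟨n, -, hn⟩ := (Matrix.isIrreducible_iff_exists_pow_pos hQ.nonneg).1 hQ k₀ k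
    refine ⟨n + 1, lt_of_lt_of_le ?_ (hs1 n k)⟩
    rw [hrec]
    refine Finset.sum_lt_sum (fun m _ => mul_le_of_le_one_left (hnn _ _ _) (hle m))
      ⟨k₀, Finset.mem_univ _, ?_⟩
    exact mul_lt_of_lt_one_left hn hlt
  choose n hn using hex
  -- Column sums decrease with the exponent, so any positive `N` above all `n k` serves every column
  -- at once.
  set N := ∑ k, n k + 1 with hN
  have hsN : ∀ k, s N k < 1 := fun k => lt_of_le_of_lt (hanti k (by
    have := Finset.single_le_sum (f := n) (fun i _ => Nat.zero_le _) (Finset.mem_univ k)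
    omega)) (hn k)
  have hsnn : ∀ n k, 0 ≤ s n k := fun n k => Finset.sum_nonneg fun l _ => hnn _ _ _
  have : Nonempty ι := ⟨k₀⟩
  obtain ⟨q, hq⟩ := Finite.exists_max fun k => s N k
  refine hasSmallPower_of_geometric (m := N) (r := s N q) (S := fun _ => 1) (by omega)
    (hsnn _ _) (hsN q) ?_
  intro j k
  simp only [abs_of_nonneg (hnn _ _ _), mul_one]
  change s (N * (j + 1)) k ≤ _
  have main : ∀ j, s (N * j) k ≤ s N q ^ j := fun j => by
    induction j with
    | zero => simpa using hs1 0 k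
    | succ j ih =>
      calc s (N * (j + 1)) k = ∑ m, s N m * (Q ^ (N * j)) m k := by
            simp only [hs, mul_add, mul_one, add_comm _ N, pow_add, colSum_mul]
        _ ≤ ∑ m, s N q * (Q ^ (N * j)) m k :=
            Finset.sum_le_sum fun m _ => mul_le_mul_of_nonneg_right (hq m) (hnn _ _ _)
        _ = s N q * s (N * j) k := by rw [Finset.mul_sum]
        _ ≤ s N q ^ (j + 1) := by
            rw [pow_succ']; exact mul_le_mul_of_nonneg_left ih (hsnn _ _)
  refine (main (j + 1)).trans ?_
  rw [pow_succ]
  exact mul_le_of_le_one_right (pow_nonneg (hsnn _ _) _) (hs1 _ _)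

theorem hasSmallPower_zero : HasSmallPower (0 : Matrix ι ι ℝ) :=
  ⟨1, one_pos, by simp⟩

end Matrices

/-! ### Norms adapted to a matrix with a small power. -/

section Gauges

variable {ι κ E : Type*} [Fintype ι] [NormedAddCommGroup E] [NormedSpace ℝ E]

/-- The matrix `T` combining a family of vectors: `T l k` is the weight of `u l` in entry `k`. -/
def combine (T : Matrix ι κ ℝ) (u : ι → E) (k : κ) : E := ∑ l, T l k • u l

theorem combine_mul {θ : Type*} [Fintype κ] (X : Matrix ι κ ℝ) (Y : Matrix κ θ ℝ) (u : ι → E) :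
    combine (X * Y) u = combine Y (combine X u) := by
  funext k
  simp only [combine, Matrix.mul_apply, Finset.sum_smul, Finset.smul_sum, smul_smul]
  rw [Finset.sum_comm]
  simp only [mul_comm]

theorem combine_one [DecidableEq ι] (u : ι → E) : combine (1 : Matrix ι ι ℝ) u = u := by
  funext k
  simp [combine, Matrix.one_apply, ite_smul]

theorem combine_add (T : Matrix ι κ ℝ) (u v : ι → E) :
    combine T (u + v) = combine T u + combine T v := by
  funext k
  simp [combine, Finset.sum_add_distrib]

theorem continuous_combine (T : Matrix ι κ ℝ) : Continuous (combine (E := E) T) := by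
  unfold combine
  fun_prop

theorem sum_norm_combine_le [Fintype κ] (T : Matrix ι κ ℝ) (u : ι → E) :
    ∑ k, ‖combine T u k‖ ≤ (∑ l, ∑ k, |T l k|) * ∑ l, ‖u l‖ := by
  calc ∑ k, ‖combine T u k‖ ≤ ∑ k, ∑ l, |T l k| * ‖u l‖ :=
        Finset.sum_le_sum fun k _ => (norm_sum_le _ _).trans (le_of_eq (by simp [norm_smul]))
    _ = ∑ l, (∑ k, |T l k|) * ‖u l‖ := by
        rw [Finset.sum_comm]; simp only [Finset.sum_mul]
    _ ≤ ∑ l, (∑ l, ∑ k, |T l k|) * ‖u l‖ := by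
        refine Finset.sum_le_sum fun l _ => mul_le_mul_of_nonneg_right ?_ (norm_nonneg _)
        exact Finset.single_le_sum (f := fun l => ∑ k, |T l k|)
          (fun i _ => Finset.sum_nonneg fun _ _ => abs_nonneg _) (Finset.mem_univ l)
    _ = _ := by rw [Finset.mul_sum]

/-- A gauge equivalent to the `ℓ¹`-norm which `T` contracts by the factor `r`. -/
structure IsContractionGauge (T : Matrix ι ι ℝ) (r c : ℝ) (φ : (ι → E) → ℝ) : Prop where
  continuous : Continuous φ
  add_le : ∀ u v, φ (u + v) ≤ φ u + φ v
  combine_le : ∀ u, φ (combine T u) ≤ r * φ u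
  le_self : ∀ u, ∑ k, ‖u k‖ ≤ φ u
  self_le : ∀ u, φ u ≤ c * ∑ k, ‖u k‖

/-- The gauge is `∑_{j<N} r⁻ʲ ‖Tʲ u‖₁`. Applying `T` shifts the sum by one index at the cost of a
factor `r`, and the new last term is at most the discarded first one. The constants `r`, `c` are
chosen before the dimension `M`, so the final rate does not depend on it. -/
theorem HasSmallPower.exists_gauge [DecidableEq ι] {T : Matrix ι ι ℝ} (hT : HasSmallPower T) :
    ∃ r c : ℝ, 0 ≤ r ∧ r < 1 ∧ 0 ≤ c ∧
      ∀ M : ℕ, ∃ φ : (ι → Strategy M) → ℝ, IsContractionGauge T r c φ := by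
  obtain ⟨N, hN, hsmall⟩ := hT
  have hN' : (1 : ℝ) ≤ N := by exact_mod_cast hN
  set r : ℝ := 1 - 1 / (2 * N) with hr
  have hinv : 1 / (2 * (N : ℝ)) ≤ 1 / 2 := by
    apply one_div_le_one_div_of_le <;> linarith
  have hinv0 : 0 < 1 / (2 * (N : ℝ)) := by positivity
  have hr0 : 0 < r := by linarith
  -- Bernoulli's inequality; the choice `r = 1 - 1 / (2 * N)` is made for this bound, which lets
  -- `r⁻¹ ^ N ≤ 2` cancel the one half in `HasSmallPower`.
  have hrN : 1 / 2 ≤ r ^ N := by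
    have := one_add_mul_le_pow (a := -(1 / (2 * (N : ℝ)))) (by linarith) N
    have h2 : (N : ℝ) * -(1 / (2 * (N : ℝ))) = -(1 / 2) := by field_simp
    rw [h2] at this
    calc (1 : ℝ) / 2 = 1 + -(1 / 2) := by norm_num
      _ ≤ _ := this
      _ = r ^ N := by rw [hr, sub_eq_add_neg]
  refine ⟨r, ∑ j ∈ Finset.range N, r⁻¹ ^ j * ∑ l, ∑ k, |(T ^ j) l k|, hr0.le, by linarith,
    by positivity, fun M => ⟨fun u => ∑ j ∈ Finset.range N, r⁻¹ ^ j *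
      ∑ k, ‖combine (T ^ j) u k‖, ?_, ?_, ?_, ?_, ?_⟩⟩
  · have := fun j => continuous_combine (E := Strategy M) (T ^ j)
    refine continuous_finsetSum _ fun j _ => continuous_const.mul
      (continuous_finsetSum _ fun k _ => ((continuous_apply k).comp (this j)).norm)
  · intro u v
    rw [← Finset.sum_add_distrib]
    refine Finset.sum_le_sum fun j _ => ?_
    rw [← mul_add, ← Finset.sum_add_distrib]
    refine mul_le_mul_of_nonneg_left (Finset.sum_le_sum fun k _ => ?_) (by positivity)
    rw [combine_add]
    exact norm_add_le _ _
  · intro u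
    set f : ℕ → ℝ := fun j => r⁻¹ ^ j * ∑ k, ‖combine (T ^ j) u k‖ with hf
    have hstep : ∀ j, r⁻¹ ^ j * ∑ k, ‖combine (T ^ j) (combine T u) k‖ = r * f (j + 1) := by
      intro j
      rw [← combine_mul, ← pow_succ', hf]
      simp only [pow_succ r⁻¹ j]
      field_simp
    simp only [hstep, ← Finset.mul_sum]
    refine mul_le_mul_of_nonneg_left ?_ hr0.le
    have h1 : ∑ j ∈ Finset.range N, f (j + 1) = ∑ j ∈ Finset.range N, f j + f N - f 0 := by
      rw [← Finset.sum_range_succ, Finset.sum_range_succ']; ring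
    have h2 : f N ≤ f 0 := by
      simp only [hf, pow_zero, one_mul, combine_one]
      have h3 := sum_norm_combine_le (T ^ N) u
      have h4 : 0 ≤ ∑ k, ‖u k‖ := Finset.sum_nonneg fun _ _ => norm_nonneg _
      have h5 : r⁻¹ ^ N ≤ 2 := by
        rw [inv_pow]; exact inv_le_of_inv_le₀ (by norm_num) (by linarith)
      calc r⁻¹ ^ N * ∑ k, ‖combine (T ^ N) u k‖ ≤ 2 * (1 / 2 * ∑ k, ‖u k‖) := by
            refine mul_le_mul h5 (h3.trans (mul_le_mul_of_nonneg_right hsmall h4)) ?_ (by norm_num)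
            exact Finset.sum_nonneg fun _ _ => norm_nonneg _
        _ = _ := by ring
    linarith
  · intro u
    refine le_trans (le_of_eq ?_) (Finset.single_le_sum
      (f := fun j => r⁻¹ ^ j * ∑ k, ‖combine (T ^ j) u k‖)
      (fun j _ => by positivity) (Finset.mem_range.2 hN))
    simp [combine_one]
  · intro u
    rw [Finset.sum_mul]
    refine Finset.sum_le_sum fun j _ => ?_
    rw [mul_assoc]
    exact mul_le_mul_of_nonneg_left (sum_norm_combine_le _ _) (by positivity)

end Gauges

/-! ### One strategy: contraction of its own and inferred copies. -/

section HalfStep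

variable {ι κ E : Type*} [Fintype ι] [Fintype κ] [NormedAddCommGroup E] [NormedSpace ℝ E]

/-- The average of a family of vectors with weights `p`. -/
def weightedMean (p : ι → ℝ) (x : ι → E) : E := ∑ k, p k • x k

theorem weightedMean_combine {A : Matrix ι ι ℝ} {p : ι → ℝ} (hp : A *ᵥ p = p) (x : ι → E) :
    weightedMean p (combine A x) = weightedMean p x := by
  simp only [weightedMean, combine, Finset.smul_sum, smul_smul]
  rw [Finset.sum_comm]
  refine Finset.sum_congr rfl fun l _ => ?_
  rw [← Finset.sum_smul]
  congr 1
  conv_rhs => rw [← hp]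
  exact Finset.sum_congr rfl fun k _ => mul_comm _ _

theorem weightedMean_sub_const {p : ι → ℝ} (hp : ∑ k, p k = 1) (x : ι → E) (a : E) :
    weightedMean p (fun k => x k - a) = weightedMean p x - a := by
  simp [weightedMean, smul_sub, Finset.sum_sub_distrib, ← Finset.sum_smul, hp]

theorem norm_weightedMean_le (p : ι → ℝ) (x : ι → E) :
    ‖weightedMean p x‖ ≤ (∑ k, |p k|) * ∑ k, ‖x k‖ := by
  rw [Finset.sum_mul]
  refine (norm_sum_le _ _).trans (Finset.sum_le_sum fun k _ => ?_)
  rw [norm_smul, Real.norm_eq_abs]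
  exact mul_le_mul_of_nonneg_left (Finset.single_le_sum (f := fun k => ‖x k‖)
    (fun i _ => norm_nonneg _) (Finset.mem_univ k)) (abs_nonneg _)

/-- The base point `a` is free because the columns of the deflation sum to zero; this is what
removes a displacement common to all agents. -/
theorem combine_sub_mean {A : Matrix ι ι ℝ} {p : ι → ℝ} (hA : ∀ k, ∑ l, A l k = 1)
    (hp : ∑ l, p l = 1) (x : ι → E) (a : E) (k : ι) :
    combine A x k - weightedMean p x = combine (deflation A p) (fun l => x l - a) k := by
  simp only [combine, weightedMean, deflation, smul_sub, sub_smul, Finset.sum_sub_distrib,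
    ← Finset.sum_smul, hA, hp]
  simp

/-- A gauge of the deviations of one strategy (own copies `u`, inferred copies `v`). -/
structure IsStepGauge (A : Matrix ι ι ℝ) (p : ι → ℝ) (R : Matrix ι κ ℝ) (Q : Matrix κ κ ℝ)
    (r c : ℝ) (φ : (ι → E) → (κ → E) → ℝ) : Prop where
  continuous : Continuous fun q : (ι → E) × (κ → E) => φ q.1 q.2
  le_self : ∀ u v, ∑ k, ‖u k‖ + ∑ k, ‖v k‖ ≤ φ u v
  self_le : ∀ u v, φ u v ≤ c * (∑ k, ‖u k‖ + ∑ k, ‖v k‖)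
  step_le : ∀ (μ : ℝ), 0 ≤ μ → ∀ (x g : ι → E) (w h : κ → E) (γ : E) (x' : ι → E) (w' : κ → E),
    (∀ k, x' k = combine A (fun l => x l - μ • g l) k) →
    (∀ k, w' k = combine R x' k + combine Q (fun l => w l + μ • h l) k) →
    φ (fun k => x' k - weightedMean p x') (fun k => w' k - weightedMean p x') ≤
      r * φ (fun k => x k - weightedMean p x) (fun k => w k - weightedMean p x) +
        μ * (c * (∑ k, ‖g k - γ‖ + ∑ k, ‖h k + γ‖))

/-- Two coupled contractions, the first weighted by a large `s`, contract jointly. -/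
theorem coupled_contraction {r₁ r₂ s m q U V F X Y : ℝ} (hr₁' : r₁ < 1)
    (hr₂ : r₂ ≤ 1) (hs : 0 ≤ s) (hm1 : (1 + r₁) / 2 ≤ m) (hm2 : r₂ ≤ m)
    (hq : q ≤ s * ((1 - r₁) / 2)) (hU : 0 ≤ U) (hV : 0 ≤ V) (hF : 0 ≤ F) (hX : 0 ≤ X)
    (hY : 0 ≤ Y) (hFU : F ≤ r₁ * (U + X)) :
    s * F + (q * F + r₂ * (V + Y)) ≤ m * (s * U + V) + (s * X + Y) := by
  have e1 : q * F ≤ s * ((1 - r₁) / 2) * F := mul_le_mul_of_nonneg_right hq hF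
  have e2 : s * ((3 - r₁) / 2) * F ≤ s * ((3 - r₁) / 2) * (r₁ * (U + X)) :=
    mul_le_mul_of_nonneg_left hFU (mul_nonneg hs (by linarith))
  -- The difference of the two sides is `(1 - r₁) ^ 2 / 2`.
  have e3 : (3 - r₁) / 2 * r₁ ≤ (1 + r₁) / 2 := by nlinarith
  have e4 := mul_le_mul_of_nonneg_right e3 (mul_nonneg hs (add_nonneg hU hX))
  have e5 := mul_le_mul_of_nonneg_right hm1 (mul_nonneg hs hU)
  have e6 := mul_le_mul_of_nonneg_right (by linarith : (1 + r₁) / 2 ≤ 1) (mul_nonneg hs hX)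
  have e7 := mul_le_mul_of_nonneg_right hm2 hV
  have e8 := mul_le_mul_of_nonneg_right hr₂ hY
  linarith

/-- The gauge is `s * φ₁ u + φ₂ v`. The new `u` enters `v` with weight at most `c₂ * ρ`, and `s` is
so large that this uses up only part of the contraction of `φ₁`. -/
theorem exists_stepGauge [DecidableEq ι] [DecidableEq κ] {A : Matrix ι ι ℝ} {p : ι → ℝ}
    {R : Matrix ι κ ℝ} {Q : Matrix κ κ ℝ} (hA : ∀ k, ∑ l, A l k = 1) (hAp : A *ᵥ p = p)
    (hp : ∑ l, p l = 1) (hRQ : ∀ k, ∑ l, R l k + ∑ l, Q l k = 1)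
    (hT : HasSmallPower (deflation A p)) (hQ : HasSmallPower Q) :
    ∃ r c : ℝ, 0 ≤ r ∧ r < 1 ∧ 0 ≤ c ∧ ∀ M : ℕ,
      ∃ φ : (ι → Strategy M) → (κ → Strategy M) → ℝ, IsStepGauge A p R Q r c φ := by
  obtain ⟨r₁, c₁, hr₁, hr₁', hc₁, H₁⟩ := hT.exists_gauge
  obtain ⟨r₂, c₂, hr₂, hr₂', hc₂, H₂⟩ := hQ.exists_gauge
  set ρ : ℝ := ∑ l, ∑ k, |R l k| with hρdef
  set π : ℝ := ∑ k, |p k| with hπdef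
  set n : ℝ := (Fintype.card κ : ℝ) with hn
  have hρ : 0 ≤ ρ := by positivity
  have hπ : 0 ≤ π := by positivity
  have hn0 : 0 ≤ n := by positivity
  have hcρ : 0 ≤ c₂ * ρ := by positivity
  obtain ⟨s, hs1, hs⟩ : ∃ s : ℝ, 1 ≤ s ∧ c₂ * ρ ≤ s * ((1 - r₁) / 2) := by
    refine ⟨1 + 2 * (c₂ * ρ) / (1 - r₁), ?_, ?_⟩
    · have := div_nonneg (mul_nonneg zero_le_two hcρ) (by linarith : (0 : ℝ) ≤ 1 - r₁)
      linarith
    · have h1 : (1 - r₁) ≠ 0 := by linarith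
      have h2 : (1 + 2 * (c₂ * ρ) / (1 - r₁)) * ((1 - r₁) / 2) = (1 - r₁) / 2 + c₂ * ρ := by
        field_simp
      rw [h2]; linarith
  have hcnπ : 0 ≤ c₂ * (n * π) := by positivity
  have hsc : 0 ≤ s * c₁ := by positivity
  refine ⟨max ((1 + r₁) / 2) r₂, 2 * (s * c₁) + c₂ + c₂ * (n * π),
    le_max_of_le_right hr₂, max_lt (by linarith) hr₂', by positivity, fun M => ?_⟩
  obtain ⟨φ₁, hφ₁⟩ := H₁ M
  obtain ⟨φ₂, hφ₂⟩ := H₂ M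
  refine ⟨fun u v => s * φ₁ u + φ₂ v, ⟨?_, ?_, ?_, ?_⟩⟩
  · exact (continuous_const.mul (hφ₁.continuous.comp continuous_fst)).add
      (hφ₂.continuous.comp continuous_snd)
  · intro u v
    have h1 := hφ₁.le_self u
    have h2 := hφ₂.le_self v
    have h3 : 0 ≤ ∑ k, ‖u k‖ := by positivity
    nlinarith
  · intro u v
    have h1 := mul_le_mul_of_nonneg_left (hφ₁.self_le u) (by linarith : (0 : ℝ) ≤ s)
    have h2 := hφ₂.self_le v
    have h3 : 0 ≤ ∑ k, ‖u k‖ := by positivity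
    have h4 : 0 ≤ ∑ k, ‖v k‖ := by positivity
    nlinarith [mul_nonneg hc₂ h3, mul_nonneg hsc h4, mul_nonneg hsc h3, mul_nonneg hcnπ h3,
      mul_nonneg hcnπ h4]
  · intro μ hμ x g w h γ x' w' hx' hw'
    set a := weightedMean p x with ha
    set b := ∑ k, ‖g k - γ‖ with hb
    set d := ∑ k, ‖h k + γ‖ with hd
    have hb0 : 0 ≤ b := by positivity
    have hd0 : 0 ≤ d := by positivity
    set e : Strategy M := weightedMean p fun k => g k - γ with he
    have hx'' : x' = combine A fun l => x l - μ • g l := funext hx'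
    -- Combination preserves the Perron mean, so the centroid moves by `-μγ` up to the mean residual
    -- `e`.
    have hmean : weightedMean p x' = a - μ • γ - μ • e := by
      rw [hx'', weightedMean_combine hAp, he, weightedMean_sub_const hp, smul_sub]
      simp only [weightedMean, ha, smul_sub, Finset.sum_sub_distrib, Finset.smul_sum]
      simp only [smul_comm μ]
      abel
    have hu : (fun k => x' k - weightedMean p x') = combine (deflation A p)
        ((fun k => x k - a) + fun k => -(μ • (g k - γ))) := by
      funext k
      rw [hx'', weightedMean_combine hAp, combine_sub_mean hA hp _ (a - μ • γ)]
      congr 1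
      funext l
      simp only [Pi.add_apply, smul_sub]
      abel
    -- The columns of `R` and `Q` together sum to one, so the new centroid can be subtracted inside
    -- both sums; `+μh` then meets the displacement `-μ(γ + e)` of the centroid and leaves the
    -- residual `h + γ + e`.
    have hv : (fun k => w' k - weightedMean p x') =
        combine R (fun k => x' k - weightedMean p x') +
          combine Q ((fun k => w k - a) + fun k => μ • (h k + γ + e)) := by
      funext k
      have h1 : weightedMean p x' =
          ∑ l, R l k • weightedMean p x' + ∑ l, Q l k • weightedMean p x' := by
        rw [← Finset.sum_smul, ← Finset.sum_smul, ← add_smul, hRQ, one_smul]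
      have h2 : ∀ l, (fun k => w k - a) l + (fun k => μ • (h k + γ + e)) l =
          (w l + μ • h l) - weightedMean p x' := fun l => by
        rw [hmean]; simp only [smul_add]; abel
      rw [hw']
      simp only [Pi.add_apply, combine, h2]
      conv_lhs => rw [h1]
      simp only [smul_sub, Finset.sum_sub_distrib]
      abel
    set u : ι → Strategy M := fun k => x k - a
    set v : κ → Strategy M := fun k => w k - a
    have hb1 : ∑ k, ‖-(μ • (g k - γ))‖ = μ * b := by
      simp only [norm_neg, norm_smul, Real.norm_of_nonneg hμ, hb, Finset.mul_sum]
    have hd1 : ∑ k, ‖μ • (h k + γ + e)‖ ≤ μ * (d + n * (π * b)) := by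
      simp only [norm_smul, Real.norm_of_nonneg hμ, ← Finset.mul_sum]
      refine mul_le_mul_of_nonneg_left ?_ hμ
      calc ∑ k, ‖h k + γ + e‖ ≤ ∑ k, (‖h k + γ‖ + π * b) :=
            Finset.sum_le_sum fun k _ => (norm_add_le _ _).trans
              (add_le_add_right (norm_weightedMean_le _ _) _)
        _ = _ := by simp [Finset.sum_add_distrib, hd, hn]
    have hF1 : φ₁ (fun k => x' k - weightedMean p x') ≤ r₁ * (φ₁ u + c₁ * (μ * b)) := by
      rw [hu]
      refine (hφ₁.combine_le _).trans (mul_le_mul_of_nonneg_left ?_ hr₁)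
      refine (hφ₁.add_le _ _).trans (add_le_add_right ?_ _)
      rw [← hb1]
      exact hφ₁.self_le _
    have hF2 : φ₂ (fun k => w' k - weightedMean p x') ≤
        c₂ * (ρ * φ₁ (fun k => x' k - weightedMean p x')) +
          r₂ * (φ₂ v + c₂ * (μ * (d + n * (π * b)))) := by
      rw [hv]
      refine (hφ₂.add_le _ _).trans (add_le_add ?_ ?_)
      · refine (hφ₂.self_le _).trans (mul_le_mul_of_nonneg_left ?_ hc₂)
        exact (sum_norm_combine_le _ _).trans (mul_le_mul_of_nonneg_left (hφ₁.le_self _) hρ)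
      · refine (hφ₂.combine_le _).trans (mul_le_mul_of_nonneg_left ?_ hr₂)
        refine (hφ₂.add_le _ _).trans (add_le_add_right ?_ _)
        exact (hφ₂.self_le _).trans (mul_le_mul_of_nonneg_left hd1 hc₂)
    have hU : 0 ≤ φ₁ u := le_trans (by positivity) (hφ₁.le_self u)
    have hV : 0 ≤ φ₂ v := le_trans (by positivity) (hφ₂.le_self v)
    have hs0 : 0 ≤ s := by linarith
    set F := φ₁ (fun k => x' k - weightedMean p x')
    have hF0 : 0 ≤ F := le_trans (by positivity) (hφ₁.le_self _)
    set X := c₁ * (μ * b)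
    set Y := c₂ * (μ * (d + n * (π * b))) with hY
    have hX : 0 ≤ X := by positivity
    have hY0 : 0 ≤ Y := by positivity
    have k3 := coupled_contraction hr₁' hr₂'.le hs0 (le_max_left _ _) (le_max_right _ _)
      hs hU hV hF0 hX hY0 hF1
    have k4 : s * X + Y ≤ μ * ((2 * (s * c₁) + c₂ + c₂ * (n * π)) * (b + d)) := by
      have : μ * ((2 * (s * c₁) + c₂ + c₂ * (n * π)) * (b + d)) - (s * X + Y) =
          μ * (s * c₁ * b + 2 * (s * c₁) * d + c₂ * b + c₂ * (n * π) * d) := by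
        simp only [X, Y]; ring
      have : 0 ≤ μ * (s * c₁ * b + 2 * (s * c₁) * d + c₂ * b + c₂ * (n * π) * d) := by
        positivity
      linarith
    calc s * F + _ ≤ s * F + (c₂ * ρ * F + r₂ * (φ₂ v + Y)) := by
          rw [mul_assoc]; exact add_le_add_right hF2 _
      _ ≤ max ((1 + r₁) / 2) r₂ * (s * φ₁ u + φ₂ v) + (s * X + Y) := k3
      _ ≤ _ := add_le_add_right k4 _

end HalfStep

/-! ### Both strategies together, and the size of the gradient residuals. -/

section Profiles

variable {K₁ K₂ M₁ M₂ : ℕ}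

/-- Componentwise measurability of a random profile. -/
structure MeasurableProfile {Ω : Type*} [MeasurableSpace Ω] (Z : Ω → Profile K₁ K₂ M₁ M₂) :
    Prop where
  x : ∀ k, Measurable fun ω => (Z ω).x k
  y : ∀ k, Measurable fun ω => (Z ω).y k

/-- Sum of the distances of all copies of the strategies from the team centroids. -/
noncomputable def totalDistance (p₁ : Fin K₁ → ℝ) (p₂ : Fin K₂ → ℝ) (z : Profile K₁ K₂ M₁ M₂) :
    ℝ :=
  ∑ k, (‖z.x k - centroidX p₁ z‖ + ‖z.y k - centroidY p₂ z‖)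

theorem deviation_eq_sum (p₁ : Fin K₁ → ℝ) (p₂ : Fin K₂ → ℝ) (z : Profile K₁ K₂ M₁ M₂) :
    deviation p₁ p₂ z =
      ∑ k, (‖z.x k - centroidX p₁ z‖ ^ 2 + ‖z.y k - centroidY p₂ z‖ ^ 2) := by
  rw [deviation, Finset.sum_add_distrib, Fintype.sum_sum_type, Fintype.sum_sum_type]
  ring

theorem totalDistance_nonneg (p₁ : Fin K₁ → ℝ) (p₂ : Fin K₂ → ℝ) (z : Profile K₁ K₂ M₁ M₂) :
    0 ≤ totalDistance p₁ p₂ z :=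
  Finset.sum_nonneg fun _ _ => by positivity

theorem deviation_nonneg (p₁ : Fin K₁ → ℝ) (p₂ : Fin K₂ → ℝ) (z : Profile K₁ K₂ M₁ M₂) :
    0 ≤ deviation p₁ p₂ z := by
  rw [deviation_eq_sum]
  positivity

theorem deviation_le_sq_totalDistance (p₁ : Fin K₁ → ℝ) (p₂ : Fin K₂ → ℝ)
    (z : Profile K₁ K₂ M₁ M₂) : deviation p₁ p₂ z ≤ totalDistance p₁ p₂ z ^ 2 := by
  rw [deviation_eq_sum, totalDistance]
  refine le_trans (Finset.sum_le_sum fun k _ => ?_)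
    (Finset.sum_sq_le_sq_sum_of_nonneg (s := Finset.univ) fun k _ => ?_)
  · nlinarith [mul_nonneg (norm_nonneg (z.x k - centroidX p₁ z))
      (norm_nonneg (z.y k - centroidY p₂ z))]
  · positivity

theorem sq_sum_add_le {ι : Type*} [Fintype ι] (a b : ι → ℝ) :
    (∑ k, (a k + b k)) ^ 2 ≤ 2 * Fintype.card ι * ∑ k, (a k ^ 2 + b k ^ 2) := by
  refine (sq_sum_le_card_mul_sum_sq (s := Finset.univ)).trans ?_
  rw [Finset.card_univ, mul_comm (2 : ℝ), mul_assoc]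
  refine mul_le_mul_of_nonneg_left ?_ (by positivity)
  rw [Finset.mul_sum]
  exact Finset.sum_le_sum fun k _ => by nlinarith [sq_nonneg (a k - b k)]

theorem sq_totalDistance_le (p₁ : Fin K₁ → ℝ) (p₂ : Fin K₂ → ℝ) (z : Profile K₁ K₂ M₁ M₂) :
    totalDistance p₁ p₂ z ^ 2 ≤ 2 * Fintype.card (Agent K₁ K₂) * deviation p₁ p₂ z := by
  rw [deviation_eq_sum]
  exact sq_sum_add_le _ _

/-- A gauge of the distance from consensus which one iteration of ATC-ITC contracts, up to a
multiple of the deviation of the gradients from opposite reference directions. -/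
structure IsProfileGauge (A₁ : Matrix (Fin K₁) (Fin K₁) ℝ) (A₂ : Matrix (Fin K₂) (Fin K₂) ℝ)
    (C : Matrix (Agent K₁ K₂) (Agent K₁ K₂) ℝ) (p₁ : Fin K₁ → ℝ) (p₂ : Fin K₂ → ℝ) (r c : ℝ)
    (V : Profile K₁ K₂ M₁ M₂ → ℝ) : Prop where
  continuous : Continuous fun q : (Agent K₁ K₂ → Strategy M₁) × (Agent K₁ K₂ → Strategy M₂) =>
    V ⟨q.1, q.2⟩
  le_self : ∀ z, totalDistance p₁ p₂ z ≤ V z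
  self_le : ∀ z, V z ≤ c * totalDistance p₁ p₂ z
  step_le : ∀ (μ : ℝ), 0 ≤ μ → ∀ (z g : Profile K₁ K₂ M₁ M₂) (γ : Strategy M₁) (η : Strategy M₂),
    V (atcItcStep A₁ A₂ C μ z g) ≤ r * V z +
      μ * (c * ((∑ k, ‖g.x (Sum.inl k) - γ‖ + ∑ k, ‖g.x (Sum.inr k) + γ‖) +
        (∑ k, ‖g.y (Sum.inr k) - η‖ + ∑ k, ‖g.y (Sum.inl k) + η‖)))

theorem exists_profileGauge {A₁ : Matrix (Fin K₁) (Fin K₁) ℝ} {A₂ : Matrix (Fin K₂) (Fin K₂) ℝ}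
    {C : Matrix (Agent K₁ K₂) (Agent K₁ K₂) ℝ} {p₁ : Fin K₁ → ℝ} {p₂ : Fin K₂ → ℝ}
    (hA₁ : IsCombinationMatrix A₁) (hA₂ : IsCombinationMatrix A₂)
    (hp₁ : IsPerronVector A₁ p₁) (hp₂ : IsPerronVector A₂ p₂) (hC : ∀ k, ∑ l, C l k = 1)
    (hC₁ : HasSmallPower C.toBlocks₁₁) (hC₂ : HasSmallPower C.toBlocks₂₂) :
    ∃ r c : ℝ, 0 ≤ r ∧ r < 1 ∧ 0 ≤ c ∧ ∀ M₁ M₂ : ℕ, ∃ V : Profile K₁ K₂ M₁ M₂ → ℝ,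
      IsProfileGauge A₁ A₂ C p₁ p₂ r c V := by
  obtain ⟨r₁, c₁, hr₁, hr₁', hc₁, H₁⟩ := exists_stepGauge (R := C.toBlocks₁₂)
    (Q := C.toBlocks₂₂) hA₁.2.2 hp₁.1 hp₁.2
    (fun k => by simpa [Fintype.sum_sum_type, toBlocks₁₂, toBlocks₂₂] using hC (Sum.inr k))
    (hasSmallPower_deflation hA₁.1 hA₁.2 hp₁.1 hp₁.2) hC₂
  -- For `y` the teams exchange roles: Team 2 owns the strategy and Team 1 infers it.
  obtain ⟨r₂, c₂, hr₂, hr₂', hc₂, H₂⟩ := exists_stepGauge (R := C.toBlocks₂₁)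
    (Q := C.toBlocks₁₁) hA₂.2.2 hp₂.1 hp₂.2
    (fun k => by
      simpa [Fintype.sum_sum_type, toBlocks₂₁, toBlocks₁₁, add_comm] using hC (Sum.inl k))
    (hasSmallPower_deflation hA₂.1 hA₂.2 hp₂.1 hp₂.2) hC₁
  refine ⟨max r₁ r₂, max c₁ c₂, le_max_of_le_left hr₁, max_lt hr₁' hr₂', le_max_of_le_left hc₁,
    fun M₁ M₂ => ?_⟩
  obtain ⟨φ, hφ⟩ := H₁ M₁
  obtain ⟨ψ, hψ⟩ := H₂ M₂
  have htot : ∀ z : Profile K₁ K₂ M₁ M₂, totalDistance p₁ p₂ z =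
      (∑ k, ‖z.x (Sum.inl k) - centroidX p₁ z‖ + ∑ k, ‖z.x (Sum.inr k) - centroidX p₁ z‖) +
      (∑ k, ‖z.y (Sum.inr k) - centroidY p₂ z‖ + ∑ k, ‖z.y (Sum.inl k) - centroidY p₂ z‖) := by
    intro z
    rw [totalDistance, Finset.sum_add_distrib, Fintype.sum_sum_type, Fintype.sum_sum_type]
    ring
  refine ⟨fun z =>
    φ (fun k => z.x (Sum.inl k) - centroidX p₁ z) (fun k => z.x (Sum.inr k) - centroidX p₁ z) +
    ψ (fun k => z.y (Sum.inr k) - centroidY p₂ z) (fun k => z.y (Sum.inl k) - centroidY p₂ z),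
    ⟨?_, ?_, ?_, ?_⟩⟩
  · refine Continuous.add ?_ ?_
    · refine hφ.continuous.comp (Continuous.prodMk ?_ ?_) <;>
      · unfold centroidX
        fun_prop
    · refine hψ.continuous.comp (Continuous.prodMk ?_ ?_) <;>
      · unfold centroidY
        fun_prop
  · intro z
    rw [htot]
    exact add_le_add (hφ.le_self _ _) (hψ.le_self _ _)
  · intro z
    rw [htot, mul_add]
    refine add_le_add ((hφ.self_le _ _).trans ?_) ((hψ.self_le _ _).trans ?_)
    · exact mul_le_mul_of_nonneg_right (le_max_left _ _) (by positivity)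
    · exact mul_le_mul_of_nonneg_right (le_max_right _ _) (by positivity)
  · intro μ hμ z g γ η
    have h1 := hφ.step_le μ hμ (fun l => z.x (Sum.inl l)) (fun l => g.x (Sum.inl l))
      (fun l => z.x (Sum.inr l)) (fun l => g.x (Sum.inr l)) γ
      (fun k => (atcItcStep A₁ A₂ C μ z g).x (Sum.inl k))
      (fun k => (atcItcStep A₁ A₂ C μ z g).x (Sum.inr k)) (fun k => rfl) (fun k => rfl)
    have h2 := hψ.step_le μ hμ (fun l => z.y (Sum.inr l)) (fun l => g.y (Sum.inr l))
      (fun l => z.y (Sum.inl l)) (fun l => g.y (Sum.inl l)) η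
      (fun k => (atcItcStep A₁ A₂ C μ z g).y (Sum.inr k))
      (fun k => (atcItcStep A₁ A₂ C μ z g).y (Sum.inl k)) (fun k => rfl) (fun k => rfl)
    refine (add_le_add h1 h2).trans ?_
    rw [mul_add (max c₁ c₂), mul_add μ, mul_add (max r₁ r₂), add_add_add_comm]
    refine add_le_add (add_le_add ?_ ?_) (add_le_add ?_ ?_)
    · exact mul_le_mul_of_nonneg_right (le_max_left _ _)
        (le_trans (by positivity) (hφ.le_self _ _))
    · exact mul_le_mul_of_nonneg_right (le_max_right _ _)
        (le_trans (by positivity) (hψ.le_self _ _))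
    · exact mul_le_mul_of_nonneg_left
        (mul_le_mul_of_nonneg_right (le_max_left _ _) (by positivity)) hμ
    · exact mul_le_mul_of_nonneg_left
        (mul_le_mul_of_nonneg_right (le_max_right _ _) (by positivity)) hμ

/-- Total error of the gradients `g` with respect to the local gradients at the profile `z`. -/
noncomputable def gradientError (J : Agent K₁ K₂ → Strategy M₁ → Strategy M₂ → ℝ)
    (z g : Profile K₁ K₂ M₁ M₂) : ℝ :=
  ∑ k, (‖g.x k - gradX (J k) (z.x k) (z.y k)‖ + ‖g.y k - gradY (J k) (z.x k) (z.y k)‖)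

theorem gradX_neg (f : Strategy M₁ → Strategy M₂ → ℝ) (x : Strategy M₁) (y : Strategy M₂) :
    gradX (fun x y => -f x y) x y = -gradX f x y := by
  simp only [gradX, gradient, fderiv_fun_neg, map_neg]

theorem gradY_neg (f : Strategy M₁ → Strategy M₂ → ℝ) (x : Strategy M₁) (y : Strategy M₂) :
    gradY (fun x y => -f x y) x y = -gradY f x y := by
  simp only [gradY, gradient, fderiv_fun_neg, map_neg]

theorem norm_sub_le_of_lipschitz {E : Type*} [NormedAddCommGroup E] {g a b c : E} {L L' G G' δ : ℝ}
    (hδ : 0 ≤ δ) (hL : L ≤ L') (hG : G ≤ G') (h1 : ‖a - b‖ ≤ L * δ) (h2 : ‖b - c‖ ≤ G) :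
    ‖g - c‖ ≤ ‖g - a‖ + L' * δ + G' := by
  have h3 := mul_le_mul_of_nonneg_right hL hδ
  have h4 : ‖g - c‖ ≤ ‖g - a‖ + ‖a - b‖ + ‖b - c‖ := by
    calc ‖g - c‖ = ‖(g - a) + (a - b) + (b - c)‖ := by congr 1; abel
      _ ≤ _ := norm_add₃_le
  linarith

/-- The gradient of the global risk of the team of an agent. -/
noncomputable def teamGradX (p₁ : Fin K₁ → ℝ) (p₂ : Fin K₂ → ℝ)
    (J : Agent K₁ K₂ → Strategy M₁ → Strategy M₂ → ℝ) (x : Strategy M₁) (y : Strategy M₂) :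
    Agent K₁ K₂ → Strategy M₁ :=
  Sum.elim (fun _ => gradX (teamCost₁ p₁ J) x y) fun _ => gradX (teamCost₂ p₂ J) x y

/-- The gradient of the global risk of the team of an agent. -/
noncomputable def teamGradY (p₁ : Fin K₁ → ℝ) (p₂ : Fin K₂ → ℝ)
    (J : Agent K₁ K₂ → Strategy M₁ → Strategy M₂ → ℝ) (x : Strategy M₁) (y : Strategy M₂) :
    Agent K₁ K₂ → Strategy M₂ :=
  Sum.elim (fun _ => gradY (teamCost₁ p₁ J) x y) fun _ => gradY (teamCost₂ p₂ J) x y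

/-- Triangle inequality through three comparisons: sample with local gradient (noise), local
gradient at the agent's pair with that at the centroids (`Lf`), local with team gradient at the
centroids (`G`). Absolute values appear because no sign of `Lf` or `G` is assumed. -/
theorem sum_norm_sub_teamGrad_le {p₁ : Fin K₁ → ℝ} {p₂ : Fin K₂ → ℝ}
    {J : Agent K₁ K₂ → Strategy M₁ → Strategy M₂ → ℝ} {Lf G : ℝ} (hL : LipschitzGradients J Lf)
    (hG : BoundedDisagreement p₁ p₂ J G) (z g : Profile K₁ K₂ M₁ M₂) :
    ∑ k, (‖g.x k - teamGradX p₁ p₂ J (centroidX p₁ z) (centroidY p₂ z) k‖ +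
        ‖g.y k - teamGradY p₁ p₂ J (centroidX p₁ z) (centroidY p₂ z) k‖) ≤
      gradientError J z g + 2 * |Lf| * totalDistance p₁ p₂ z +
        2 * Fintype.card (Agent K₁ K₂) * |G| := by
  set a := centroidX p₁ z
  set b := centroidY p₂ z
  have hX : ∀ k, ‖gradX (J k) a b - teamGradX p₁ p₂ J a b k‖ ≤ G := by
    rintro (k | k)
    · exact hG.team₁X k a b
    · exact hG.team₂X k a b
  have hY : ∀ k, ‖gradY (J k) a b - teamGradY p₁ p₂ J a b k‖ ≤ G := by
    rintro (k | k)
    · exact hG.team₁Y k a b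
    · exact hG.team₂Y k a b
  have key : ∀ k, ‖g.x k - teamGradX p₁ p₂ J a b k‖ + ‖g.y k - teamGradY p₁ p₂ J a b k‖ ≤
      (‖g.x k - gradX (J k) (z.x k) (z.y k)‖ + ‖g.y k - gradY (J k) (z.x k) (z.y k)‖) +
        2 * |Lf| * (‖z.x k - a‖ + ‖z.y k - b‖) + 2 * |G| := fun k => by
    have hδ : 0 ≤ ‖z.x k - a‖ + ‖z.y k - b‖ := by positivity
    have h1 := norm_sub_le_of_lipschitz (g := g.x k) hδ (le_abs_self Lf) (le_abs_self G)
      (hL.lipX k (z.x k) (z.y k) a b) (hX k)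
    have h2 := norm_sub_le_of_lipschitz (g := g.y k) hδ (le_abs_self Lf) (le_abs_self G)
      (hL.lipY k (z.x k) (z.y k) a b) (hY k)
    linarith
  refine (Finset.sum_le_sum fun k _ => key k).trans (le_of_eq ?_)
  rw [Finset.sum_add_distrib, Finset.sum_add_distrib, ← Finset.mul_sum]
  simp only [gradientError, totalDistance, Finset.sum_const, Finset.card_univ, nsmul_eq_mul]
  ring

/-- If the diagonal blocks of `C` vanish, the iteration ignores the agents' own estimates of the
opponent's strategy and their gradients in it. -/
theorem atcItcStep_congr {A₁ : Matrix (Fin K₁) (Fin K₁) ℝ} {A₂ : Matrix (Fin K₂) (Fin K₂) ℝ}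
    {C : Matrix (Agent K₁ K₂) (Agent K₁ K₂) ℝ} (h₁ : C.toBlocks₁₁ = 0) (h₂ : C.toBlocks₂₂ = 0)
    (μ : ℝ) (z g g' : Profile K₁ K₂ M₁ M₂) (hx : ∀ k, g.x (Sum.inl k) = g'.x (Sum.inl k))
    (hy : ∀ k, g.y (Sum.inr k) = g'.y (Sum.inr k)) :
    atcItcStep A₁ A₂ C μ z g = atcItcStep A₁ A₂ C μ z g' := by
  have e₁ : ∀ l k, C (Sum.inl l) (Sum.inl k) = 0 := fun l k => congrFun (congrFun h₁ l) k
  have e₂ : ∀ l k, C (Sum.inr l) (Sum.inr k) = 0 := fun l k => congrFun (congrFun h₂ l) k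
  unfold atcItcStep adaptCombineX adaptCombineY
  simp only [e₁, e₂, hx, hy, zero_smul]

/-- This reduces the strong case to the analysis of ATC-ITC. -/
theorem atcCStep_eq_atcItcStep {A₁ : Matrix (Fin K₁) (Fin K₁) ℝ} {A₂ : Matrix (Fin K₂) (Fin K₂) ℝ}
    {C : Matrix (Agent K₁ K₂) (Agent K₁ K₂) ℝ} (h₁ : C.toBlocks₁₁ = 0) (h₂ : C.toBlocks₂₂ = 0)
    (μ : ℝ) : (atcCStep A₁ A₂ C μ : Profile K₁ K₂ M₁ M₂ → _) = atcItcStep A₁ A₂ C μ := by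
  have e₁ : ∀ l k, C (Sum.inl l) (Sum.inl k) = 0 := fun l k => congrFun (congrFun h₁ l) k
  have e₂ : ∀ l k, C (Sum.inr l) (Sum.inr k) = 0 := fun l k => congrFun (congrFun h₂ l) k
  funext z g
  simp only [atcCStep, atcItcStep, e₁, e₂, zero_smul, Finset.sum_const_zero, add_zero]

theorem IsProfileGauge.atcItcStep_le {A₁ : Matrix (Fin K₁) (Fin K₁) ℝ}
    {A₂ : Matrix (Fin K₂) (Fin K₂) ℝ} {C : Matrix (Agent K₁ K₂) (Agent K₁ K₂) ℝ}
    {p₁ : Fin K₁ → ℝ} {p₂ : Fin K₂ → ℝ} {r c : ℝ} {V : Profile K₁ K₂ M₁ M₂ → ℝ}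
    (hV : IsProfileGauge A₁ A₂ C p₁ p₂ r c V) (hc : 0 ≤ c)
    {J : Agent K₁ K₂ → Strategy M₁ → Strategy M₂ → ℝ} {Lf G μ : ℝ} (hμ : 0 ≤ μ)
    (hJ : IsZeroSum p₁ p₂ J ∨ C.toBlocks₁₁ = 0 ∧ C.toBlocks₂₂ = 0)
    (hL : LipschitzGradients J Lf) (hG : BoundedDisagreement p₁ p₂ J G)
    (z g : Profile K₁ K₂ M₁ M₂) :
    V (atcItcStep A₁ A₂ C μ z g) ≤ (r + μ * c * (2 * |Lf|)) * V z +
      μ * c * (2 * Fintype.card (Agent K₁ K₂) * |G| + gradientError J z g) := by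
  set a := centroidX p₁ z with ha
  set b := centroidY p₂ z with hb
  have hsum := sum_norm_sub_teamGrad_le hL hG z g
  rw [← ha, ← hb, Finset.sum_add_distrib, Fintype.sum_sum_type, Fintype.sum_sum_type] at hsum
  simp only [teamGradX, teamGradY, Sum.elim_inl, Sum.elim_inr] at hsum
  suffices h : V (atcItcStep A₁ A₂ C μ z g) ≤ r * V z + μ * (c * (gradientError J z g +
      2 * |Lf| * totalDistance p₁ p₂ z + 2 * Fintype.card (Agent K₁ K₂) * |G|)) by
    have h1 := mul_le_mul_of_nonneg_left (hV.le_self z)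
      (mul_nonneg (mul_nonneg hμ hc) (mul_nonneg zero_le_two (abs_nonneg Lf)))
    linarith
  rcases hJ with hJ | ⟨h₁, h₂⟩
  · have hfun : teamCost₁ p₁ J = fun x y => -teamCost₂ p₂ J x y := by
      funext x y; exact hJ x y
    have hγ : gradX (teamCost₁ p₁ J) a b = -gradX (teamCost₂ p₂ J) a b := by
      rw [hfun, gradX_neg]
    have hη : gradY (teamCost₁ p₁ J) a b = -gradY (teamCost₂ p₂ J) a b := by
      rw [hfun, gradY_neg]
    -- Each reference direction is the gradient of the team owning the strategy; by the zero-sum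
    -- condition its negative is the opponents' team gradient.
    refine (hV.step_le μ hμ z g (gradX (teamCost₁ p₁ J) a b) (gradY (teamCost₂ p₂ J) a b)).trans ?_
    refine add_le_add_right (mul_le_mul_of_nonneg_left (mul_le_mul_of_nonneg_left ?_ hc) hμ) _
    refine le_trans (le_of_eq ?_) hsum
    simp only [hγ, hη, sub_eq_add_neg, neg_neg]
    ring
  · set γ := gradX (teamCost₁ p₁ J) a b
    set η := gradY (teamCost₂ p₂ J) a b
    -- The gradients that do not enter are replaced by `-γ` and `-η`, so their residuals vanish.
    rw [atcItcStep_congr h₁ h₂ μ z g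
      ⟨Sum.elim (fun k => g.x (Sum.inl k)) fun _ => -γ,
        Sum.elim (fun _ => -η) fun k => g.y (Sum.inr k)⟩ (fun _ => rfl) (fun _ => rfl)]
    refine (hV.step_le μ hμ z _ γ η).trans ?_
    refine add_le_add_right (mul_le_mul_of_nonneg_left (mul_le_mul_of_nonneg_left ?_ hc) hμ) _
    refine le_trans ?_ hsum
    simp only [Sum.elim_inl, Sum.elim_inr, neg_add_cancel, norm_zero, Finset.sum_const_zero,
      add_zero]
    have n1 : 0 ≤ ∑ k, ‖g.x (Sum.inr k) - gradX (teamCost₂ p₂ J) a b‖ := by positivity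
    have n2 : 0 ≤ ∑ k, ‖g.y (Sum.inl k) - gradY (teamCost₁ p₁ J) a b‖ := by positivity
    linarith

end Profiles

/-! ### The scalar mean-square recursion. -/

section Recursion

/-- Convexity of the square applied to `ρ * v + (1 - ρ) * (t / (1 - ρ))`; the rate stays `ρ` after
squaring. -/
theorem sq_le_convex_combination {ρ v t w : ℝ} (hρ0 : 0 ≤ ρ) (hρ1 : ρ < 1) (hw : 0 ≤ w)
    (h : w ≤ ρ * v + t) : w ^ 2 ≤ ρ * v ^ 2 + t ^ 2 / (1 - ρ) := by
  have h1 : 0 < 1 - ρ := by linarith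
  have h2 : w ^ 2 ≤ (ρ * v + t) ^ 2 := pow_le_pow_left₀ hw h 2
  have h3 : ρ * v ^ 2 + t ^ 2 / (1 - ρ) - (ρ * v + t) ^ 2 =
      ρ * ((1 - ρ) * v - t) ^ 2 / (1 - ρ) := by
    field_simp
    ring
  have h4 : 0 ≤ ρ * ((1 - ρ) * v - t) ^ 2 / (1 - ρ) := by positivity
  linarith

/-- A contraction perturbed by square-integrable terms of size `ε` stays bounded in mean square by
the decaying initial value plus a term of order `ε²`. -/
theorem integral_sq_le_of_recursion {Ω : Type*} [MeasurableSpace Ω] {P : Measure Ω}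
    [IsProbabilityMeasure P] {V N Q : ℕ → Ω → ℝ} {ρ ε g τ : ℝ} (hρ0 : 0 ≤ ρ) (hρ1 : ρ < 1)
    (hVm : ∀ n, Measurable (V n)) (hV0 : ∀ n ω, 0 ≤ V n ω)
    (hrec : ∀ n ω, V (n + 1) ω ≤ ρ * V n ω + ε * (g + N n ω))
    (hNQ : ∀ n ω, N n ω ^ 2 ≤ Q n ω) (hQ : ∀ n, Integrable (Q n) P)
    (hQτ : ∀ n, ∫ ω, Q n ω ∂P ≤ τ) (hinit : Integrable (fun ω => V 0 ω ^ 2) P) (n : ℕ) :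
    Integrable (fun ω => V n ω ^ 2) P ∧
      ∫ ω, V n ω ^ 2 ∂P ≤ ρ ^ n * ∫ ω, V 0 ω ^ 2 ∂P +
        ε ^ 2 * ((2 * g ^ 2 + 2 * τ) / (1 - ρ) ^ 2) := by
  have h1 : 0 < 1 - ρ := by linarith
  have hsq : ∀ n ω, V (n + 1) ω ^ 2 ≤
      ρ * V n ω ^ 2 + ε ^ 2 / (1 - ρ) * (2 * g ^ 2 + 2 * Q n ω) := fun n ω => by
    refine (sq_le_convex_combination hρ0 hρ1 (hV0 _ _) (hrec n ω)).trans ?_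
    refine add_le_add_right ?_ _
    rw [mul_pow, mul_div_right_comm]
    refine mul_le_mul_of_nonneg_left ?_ (by positivity)
    nlinarith [hNQ n ω, sq_nonneg (g - N n ω)]
  have hnoise : ∀ n, Integrable (fun ω => ε ^ 2 / (1 - ρ) * (2 * g ^ 2 + 2 * Q n ω)) P :=
    fun n => ((integrable_const _).add ((hQ n).const_mul 2)).const_mul _
  have hτ0 : 0 ≤ τ := (integral_nonneg fun ω => (sq_nonneg _).trans (hNQ 0 ω)).trans (hQτ 0)
  induction n with
  | zero =>
    refine ⟨hinit, ?_⟩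
    rw [pow_zero, one_mul]
    have : 0 ≤ ε ^ 2 * ((2 * g ^ 2 + 2 * τ) / (1 - ρ) ^ 2) := by positivity
    linarith
  | succ n ih =>
    have hbound := (ih.1.const_mul ρ).add (hnoise n)
    have hint : Integrable (fun ω => V (n + 1) ω ^ 2) P := by
      refine hbound.mono' ((hVm _).pow_const 2).aestronglyMeasurable (ae_of_all _ fun ω => ?_)
      rw [Real.norm_of_nonneg (sq_nonneg _)]
      exact hsq n ω
    refine ⟨hint, ?_⟩
    calc ∫ ω, V (n + 1) ω ^ 2 ∂P
        ≤ ∫ ω, (ρ * V n ω ^ 2 + ε ^ 2 / (1 - ρ) * (2 * g ^ 2 + 2 * Q n ω)) ∂P :=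
          integral_mono hint hbound (hsq n)
      _ = ρ * ∫ ω, V n ω ^ 2 ∂P + ε ^ 2 / (1 - ρ) * (2 * g ^ 2 + 2 * ∫ ω, Q n ω ∂P) := by
          rw [integral_add (ih.1.const_mul ρ) (hnoise n), integral_const_mul, integral_const_mul,
            integral_add (integrable_const _) ((hQ n).const_mul 2)]
          simp [integral_const_mul]
      _ ≤ ρ * (ρ ^ n * ∫ ω, V 0 ω ^ 2 ∂P + ε ^ 2 * ((2 * g ^ 2 + 2 * τ) / (1 - ρ) ^ 2)) +
            ε ^ 2 / (1 - ρ) * (2 * g ^ 2 + 2 * τ) := by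
          refine add_le_add (mul_le_mul_of_nonneg_left ih.2 hρ0)
            (mul_le_mul_of_nonneg_left ?_ (by positivity))
          linarith [hQτ n]
      _ = _ := by
          field_simp
          ring

theorem pow_le_of_log_div_log_le {ρ a : ℝ} (hρ0 : 0 < ρ) (hρ1 : ρ < 1) (ha : 0 < a) {i : ℕ}
    (h : Real.log a / Real.log ρ ≤ i) : ρ ^ i ≤ a := by
  rw [div_le_iff_of_neg (Real.log_neg hρ0 hρ1), ← Real.log_pow] at h
  exact (Real.log_le_log_iff (pow_pos hρ0 i) ha).1 h

end Recursion

/-! ### Measurability, and moments of the gradient noise. -/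

section Stochastic

variable {K₁ K₂ M₁ M₂ : ℕ} {Ω : Type*} [MeasurableSpace Ω]

theorem MeasurableProfile.atcItcStep {Z g : Ω → Profile K₁ K₂ M₁ M₂} (hZ : MeasurableProfile Z)
    (hg : MeasurableProfile g) (A₁ : Matrix (Fin K₁) (Fin K₁) ℝ)
    (A₂ : Matrix (Fin K₂) (Fin K₂) ℝ) (C : Matrix (Agent K₁ K₂) (Agent K₁ K₂) ℝ) (μ : ℝ) :
    MeasurableProfile fun ω => atcItcStep A₁ A₂ C μ (Z ω) (g ω) := by
  have h1 := hZ.x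
  have h2 := hZ.y
  have h3 := hg.x
  have h4 := hg.y
  constructor <;> rintro (k | k) <;>
  · simp only [_root_.atcItcStep, adaptCombineX, adaptCombineY, Sum.elim_inl, Sum.elim_inr]
    fun_prop

/-- The stochastic gradients which the agents query at the profile `Z n`. -/
def queriedGradients (S : StochasticGradients Ω K₁ K₂ M₁ M₂) (Z : ℕ → Ω → Profile K₁ K₂ M₁ M₂)
    (n : ℕ) (ω : Ω) : Profile K₁ K₂ M₁ M₂ :=
  ⟨fun k => S.gx n k ((Z n ω).x k) ((Z n ω).y k) ω,
    fun k => S.gy n k ((Z n ω).x k) ((Z n ω).y k) ω⟩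

theorem GradientNoise.measurableProfile_queriedGradients {P : Measure Ω}
    {J : Agent K₁ K₂ → Strategy M₁ → Strategy M₂ → ℝ} {S : StochasticGradients Ω K₁ K₂ M₁ M₂}
    {Z : ℕ → Ω → Profile K₁ K₂ M₁ M₂} {σ : ℝ} (hS : GradientNoise P J S Z σ) {n : ℕ}
    (hZ : MeasurableProfile (Z n)) : MeasurableProfile (queriedGradients S Z n) :=
  ⟨fun k => (hS.measX n k).comp ((hZ.x k).prodMk ((hZ.y k).prodMk measurable_id)),
    fun k => (hS.measY n k).comp ((hZ.x k).prodMk ((hZ.y k).prodMk measurable_id))⟩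

theorem GradientNoise.measurableProfile_iterates {P : Measure Ω}
    {J : Agent K₁ K₂ → Strategy M₁ → Strategy M₂ → ℝ} {S : StochasticGradients Ω K₁ K₂ M₁ M₂}
    {A₁ : Matrix (Fin K₁) (Fin K₁) ℝ} {A₂ : Matrix (Fin K₂) (Fin K₂) ℝ}
    {C : Matrix (Agent K₁ K₂) (Agent K₁ K₂) ℝ} {μ : ℝ} {z₀ : Ω → Profile K₁ K₂ M₁ M₂} {σ : ℝ}
    (hS : GradientNoise P J S (iterates (atcItcStep A₁ A₂ C μ) S z₀) σ)
    (hz₀ : MeasurableProfile z₀) (n : ℕ) :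
    MeasurableProfile (iterates (atcItcStep A₁ A₂ C μ) S z₀ n) := by
  induction n with
  | zero => exact hz₀
  | succ n ih => exact ih.atcItcStep (hS.measurableProfile_queriedGradients ih) A₁ A₂ C μ

theorem history_le {Z : ℕ → Ω → Profile K₁ K₂ M₁ M₂} (hZ : ∀ n, MeasurableProfile (Z n)) (n : ℕ) :
    history Z n ≤ ‹MeasurableSpace Ω› :=
  iSup_le fun j => iSup_le fun _ => iSup_le fun k =>
    sup_le ((hZ j).x k).comap_le ((hZ j).y k).comap_le

theorem integral_le_of_condExp_le {Ω : Type*} {m m₀ : MeasurableSpace Ω} {P : Measure Ω}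
    [IsProbabilityMeasure P] (hm : m ≤ m₀) {f : Ω → ℝ} {a : ℝ} (h : P[f | m] ≤ᵐ[P] fun _ => a) :
    ∫ ω, f ω ∂P ≤ a := by
  rw [← integral_condExp hm]
  refine (integral_mono_ae integrable_condExp (integrable_const a) h).trans (by simp)

/-- The square of the total gradient error is dominated by an integrable function. -/
theorem GradientNoise.exists_dominating {P : Measure Ω} [IsProbabilityMeasure P]
    {J : Agent K₁ K₂ → Strategy M₁ → Strategy M₂ → ℝ} {S : StochasticGradients Ω K₁ K₂ M₁ M₂}
    {Z : ℕ → Ω → Profile K₁ K₂ M₁ M₂} {σ : ℝ} (hS : GradientNoise P J S Z σ)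
    (hZ : ∀ n, MeasurableProfile (Z n)) (n : ℕ) :
    ∃ Q : Ω → ℝ, (∀ ω, gradientError J (Z n ω) (queriedGradients S Z n ω) ^ 2 ≤ Q ω) ∧
      Integrable Q P ∧ ∫ ω, Q ω ∂P ≤ (2 * Fintype.card (Agent K₁ K₂) * σ) ^ 2 := by
  have hint : ∀ k, Integrable (fun ω =>
      ‖S.gx n k ((Z n ω).x k) ((Z n ω).y k) ω - gradX (J k) ((Z n ω).x k) ((Z n ω).y k)‖ ^ 2 +
      ‖S.gy n k ((Z n ω).x k) ((Z n ω).y k) ω - gradY (J k) ((Z n ω).x k) ((Z n ω).y k)‖ ^ 2) P :=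
    fun k => (hS.integrableX n k).add (hS.integrableY n k)
  refine ⟨_, fun ω => sq_sum_add_le _ _,
    (integrable_finsetSum _ fun k _ => hint k).const_mul _, ?_⟩
  simp only [queriedGradients]
  rw [integral_const_mul, integral_finsetSum _ fun k _ => hint k]
  have h1 : ∀ k, ∫ ω, (‖S.gx n k ((Z n ω).x k) ((Z n ω).y k) ω -
      gradX (J k) ((Z n ω).x k) ((Z n ω).y k)‖ ^ 2 + ‖S.gy n k ((Z n ω).x k) ((Z n ω).y k) ω -
      gradY (J k) ((Z n ω).x k) ((Z n ω).y k)‖ ^ 2) ∂P ≤ 2 * σ ^ 2 := fun k => by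
    rw [integral_add (hS.integrableX n k) (hS.integrableY n k)]
    have h2 := integral_le_of_condExp_le (history_le hZ n) (hS.varianceX n k)
    have h3 := integral_le_of_condExp_le (history_le hZ n) (hS.varianceY n k)
    linarith
  refine (mul_le_mul_of_nonneg_left (Finset.sum_le_sum fun k _ => h1 k) (by positivity)).trans
    (le_of_eq ?_)
  simp only [Finset.sum_const, Finset.card_univ, nsmul_eq_mul]
  ring

theorem measurable_deviation {Z : Ω → Profile K₁ K₂ M₁ M₂} (hZ : MeasurableProfile Z)
    (p₁ : Fin K₁ → ℝ) (p₂ : Fin K₂ → ℝ) : Measurable fun ω => deviation p₁ p₂ (Z ω) := by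
  have h1 := hZ.x
  have h2 := hZ.y
  unfold deviation centroidX centroidY
  fun_prop

theorem SquareIntegrableInit.integrable_deviation {P : Measure Ω} {z₀ : Ω → Profile K₁ K₂ M₁ M₂}
    (h : SquareIntegrableInit P z₀) (p₁ : Fin K₁ → ℝ) (p₂ : Fin K₂ → ℝ) :
    Integrable (fun ω => deviation p₁ p₂ (z₀ ω)) P := by
  have hx : MemLp (fun ω => centroidX p₁ (z₀ ω)) 2 P :=
    memLp_finsetSum _ fun k _ => (h.memLpX (Sum.inl k)).const_smul (p₁ k)
  have hy : MemLp (fun ω => centroidY p₂ (z₀ ω)) 2 P :=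
    memLp_finsetSum _ fun k _ => (h.memLpY (Sum.inr k)).const_smul (p₂ k)
  simp only [deviation_eq_sum]
  exact integrable_finsetSum _ fun k _ =>
    (((h.memLpX k).sub hx).integrable_norm_pow two_ne_zero).add
      (((h.memLpY k).sub hy).integrable_norm_pow two_ne_zero)

end Stochastic

/-! ### Mean-square consensus of ATC-ITC. -/

theorem IsProfileGauge.measurable {K₁ K₂ M₁ M₂ : ℕ} {A₁ : Matrix (Fin K₁) (Fin K₁) ℝ}
    {A₂ : Matrix (Fin K₂) (Fin K₂) ℝ} {C : Matrix (Agent K₁ K₂) (Agent K₁ K₂) ℝ}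
    {p₁ : Fin K₁ → ℝ} {p₂ : Fin K₂ → ℝ} {r c : ℝ} {V : Profile K₁ K₂ M₁ M₂ → ℝ}
    (hV : IsProfileGauge A₁ A₂ C p₁ p₂ r c V) {Ω : Type*} [MeasurableSpace Ω]
    {Z : Ω → Profile K₁ K₂ M₁ M₂} (hZ : MeasurableProfile Z) : Measurable fun ω => V (Z ω) :=
  hV.continuous.measurable.comp
    ((measurable_pi_iff.2 hZ.x).prodMk (measurable_pi_iff.2 hZ.y))

/-- Consensus of ATC-ITC for inference matrices with convergent diagonal blocks, if the objectives
are zero-sum or the diagonal blocks vanish. -/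
theorem consensus_atcItc {K₁ K₂ : ℕ} {A₁ : Matrix (Fin K₁) (Fin K₁) ℝ}
    {A₂ : Matrix (Fin K₂) (Fin K₂) ℝ} {C : Matrix (Agent K₁ K₂) (Agent K₁ K₂) ℝ}
    {p₁ : Fin K₁ → ℝ} {p₂ : Fin K₂ → ℝ} (hA₁ : IsCombinationMatrix A₁)
    (hA₂ : IsCombinationMatrix A₂) (hp₁ : IsPerronVector A₁ p₁) (hp₂ : IsPerronVector A₂ p₂)
    (hC : ∀ k, ∑ l, C l k = 1) (hC₁ : HasSmallPower C.toBlocks₁₁)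
    (hC₂ : HasSmallPower C.toBlocks₂₂) :
    ∃ α : ℝ, 0 < α ∧ α < 1 ∧
      ∀ Lf : ℝ, ∃ μ₀ : ℝ, 0 < μ₀ ∧ ∀ G σ D κ : ℝ, 0 < κ → ∃ B : ℝ,
        ∀ (M₁ M₂ : ℕ) (J : Agent K₁ K₂ → Strategy M₁ → Strategy M₂ → ℝ),
          (IsZeroSum p₁ p₂ J ∨ C.toBlocks₁₁ = 0 ∧ C.toBlocks₂₂ = 0) →
          LipschitzGradients J Lf → BoundedDisagreement p₁ p₂ J G →
        ∀ (Ω : Type*) [MeasurableSpace Ω] (P : Measure Ω) [IsProbabilityMeasure P]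
          (S : StochasticGradients Ω K₁ K₂ M₁ M₂) (z₀ : Ω → Profile K₁ K₂ M₁ M₂) (μ : ℝ),
          0 < μ → μ ≤ μ₀ →
          SquareIntegrableInit P z₀ → ∫ ω, deviation p₁ p₂ (z₀ ω) ∂P ≤ D →
          GradientNoise P J S (iterates (atcItcStep A₁ A₂ C μ) S z₀) σ →
        ∀ i : ℕ, Real.log (κ * μ ^ 2) / Real.log α ≤ i →
          Integrable
            (fun ω => deviation p₁ p₂ (iterates (atcItcStep A₁ A₂ C μ) S z₀ (i + 1) ω)) P ∧
          ∫ ω, deviation p₁ p₂ (iterates (atcItcStep A₁ A₂ C μ) S z₀ (i + 1) ω) ∂P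
            ≤ B * μ ^ 2 := by
  obtain ⟨r, c, hr0, hr1, hc, H⟩ := exists_profileGauge hA₁ hA₂ hp₁ hp₂ hC hC₁ hC₂
  set ρ := (1 + r) / 2 with hρ
  have hρ0 : 0 < ρ := by linarith
  have hρ1 : ρ < 1 := by linarith
  set n : ℝ := (Fintype.card (Agent K₁ K₂) : ℝ)
  refine ⟨ρ, hρ0, hρ1, fun Lf => ?_⟩
  have hcL : 0 ≤ c * (2 * |Lf|) := by positivity
  -- With this `μ₀` the Lipschitz term costs at most `(1 - r) / 2`, half of the contraction margin;
  -- the `+ 1` keeps the denominator positive when `c * |Lf| = 0`.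
  refine ⟨(1 - r) / (2 * (c * (2 * |Lf|) + 1)), div_pos (by linarith) (by positivity),
    fun G σ D κ hκ => ?_⟩
  -- The first summand of `B` pays for the transient, the second for the steady state with gradient
  -- disagreement and noise.
  refine ⟨κ * (c ^ 2 * (2 * n * D)) +
    c ^ 2 * ((2 * (2 * n * |G|) ^ 2 + 2 * (2 * n * σ) ^ 2) / (1 - ρ) ^ 2), ?_⟩
  intro M₁ M₂ J hJ hL hG Ω _ P _ S z₀ μ hμ hμ₀ hz₀ hD hS i hi
  obtain ⟨V, hV⟩ := H M₁ M₂
  set Z := iterates (atcItcStep A₁ A₂ C μ) S z₀ with hZdef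
  have hZ : ∀ n, MeasurableProfile (Z n) :=
    hS.measurableProfile_iterates ⟨hz₀.measX, hz₀.measY⟩
  have hrate : r + μ * c * (2 * |Lf|) ≤ ρ := by
    have h1 : μ * (c * (2 * |Lf|)) ≤ μ * (c * (2 * |Lf|) + 1) := by linarith
    have h2 := (le_div_iff₀ (by positivity)).1 hμ₀
    linarith
  have hV0 : ∀ z, 0 ≤ V z := fun z => (totalDistance_nonneg p₁ p₂ z).trans (hV.le_self z)
  have hrec : ∀ n ω, V (Z (n + 1) ω) ≤ ρ * V (Z n ω) + μ * c *
      (2 * Fintype.card (Agent K₁ K₂) * |G| +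
        gradientError J (Z n ω) (queriedGradients S Z n ω)) := fun n ω =>
    (hV.atcItcStep_le hc hμ.le hJ hL hG (Z n ω) (queriedGradients S Z n ω)).trans
      (add_le_add_left (mul_le_mul_of_nonneg_right hrate (hV0 _)) _)
  choose Q hNQ hQ hQσ using hS.exists_dominating hZ
  have hdev0 := hz₀.integrable_deviation p₁ p₂
  have hVdev : ∀ ω, V (z₀ ω) ^ 2 ≤ c ^ 2 * (2 * n * deviation p₁ p₂ (z₀ ω)) := fun ω => by
    refine (pow_le_pow_left₀ (hV0 _) (hV.self_le _) 2).trans ?_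
    rw [mul_pow]
    exact mul_le_mul_of_nonneg_left (sq_totalDistance_le _ _ _) (sq_nonneg c)
  have hdom0 : Integrable (fun ω => c ^ 2 * (2 * n * deviation p₁ p₂ (z₀ ω))) P :=
    (hdev0.const_mul _).const_mul _
  have hinit : Integrable (fun ω => V (Z 0 ω) ^ 2) P := by
    refine hdom0.mono' ((hV.measurable (hZ 0)).pow_const 2).aestronglyMeasurable
      (ae_of_all _ fun ω => ?_)
    rw [Real.norm_of_nonneg (sq_nonneg _)]
    exact hVdev ω
  have hinit' : ∫ ω, V (Z 0 ω) ^ 2 ∂P ≤ c ^ 2 * (2 * n * D) := by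
    refine (integral_mono hinit hdom0 hVdev).trans ?_
    rw [integral_const_mul, integral_const_mul]
    exact mul_le_mul_of_nonneg_left (mul_le_mul_of_nonneg_left hD (by positivity)) (sq_nonneg c)
  obtain ⟨hint, hle⟩ := integral_sq_le_of_recursion (V := fun n ω => V (Z n ω)) hρ0.le hρ1
    (fun n => hV.measurable (hZ n)) (fun n ω => hV0 _) hrec hNQ hQ hQσ hinit (i + 1)
  have hdev : ∀ ω, deviation p₁ p₂ (Z (i + 1) ω) ≤ V (Z (i + 1) ω) ^ 2 := fun ω =>
    (deviation_le_sq_totalDistance _ _ _).trans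
      (pow_le_pow_left₀ (totalDistance_nonneg _ _ _) (hV.le_self _) 2)
  have hdevint : Integrable (fun ω => deviation p₁ p₂ (Z (i + 1) ω)) P := by
    refine hint.mono' (measurable_deviation (hZ _) p₁ p₂).aestronglyMeasurable
      (ae_of_all _ fun ω => ?_)
    rw [Real.norm_of_nonneg (deviation_nonneg _ _ _)]
    exact hdev ω
  refine ⟨hdevint, (integral_mono hdevint hint hdev).trans (hle.trans ?_)⟩
  -- Time `i` has index `i + 1`, so there is one factor `ρ` to spare.
  have hpow : ρ ^ (i + 1) ≤ κ * μ ^ 2 :=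
    (pow_le_pow_of_le_one hρ0.le hρ1.le (Nat.le_succ i)).trans
      (pow_le_of_log_div_log_le hρ0 hρ1 (by positivity) hi)
  have hfirst : ρ ^ (i + 1) * ∫ ω, V (Z 0 ω) ^ 2 ∂P ≤ κ * μ ^ 2 * (c ^ 2 * (2 * n * D)) :=
    mul_le_mul hpow hinit' (integral_nonneg fun ω => sq_nonneg _) (by positivity)
  refine (add_le_add_left hfirst _).trans (le_of_eq ?_)
  ring

/-! ### Weak and strong inference matrices, and the conclusion. -/

theorem hasSmallPower_toBlocks₂₂ {K₁ K₂ : ℕ} {C : Matrix (Agent K₁ K₂) (Agent K₁ K₂) ℝ}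
    (hC : IsLeftStochastic C) (hirr : C.toBlocks₂₂.IsIrreducible)
    (h : ∃ (k : Fin K₂) (l : Fin K₁), 0 < C (Sum.inl l) (Sum.inr k)) :
    HasSmallPower C.toBlocks₂₂ := by
  have hcol : ∀ k, ∑ l, C (Sum.inl l) (Sum.inr k) + ∑ l, C.toBlocks₂₂ l k = 1 := fun k => by
    simpa [Fintype.sum_sum_type, toBlocks₂₂] using hC.2 (Sum.inr k)
  obtain ⟨k₀, l₀, hpos⟩ := h
  -- A positive cross-team weight in column `k₀` is exactly mass missing from the diagonal block.
  refine hasSmallPower_of_substochastic hirr (fun k => ?_) (k₀ := k₀) ?_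
  · have := Finset.sum_nonneg fun (l : Fin K₁) (_ : l ∈ Finset.univ) => hC.1 (Sum.inl l) (Sum.inr k)
    linarith [hcol k]
  · have : 0 < ∑ l, C (Sum.inl l) (Sum.inr k₀) :=
      Finset.sum_pos' (fun l _ => hC.1 _ _) ⟨l₀, Finset.mem_univ _, hpos⟩
    linarith [hcol k₀]

theorem hasSmallPower_toBlocks₁₁ {K₁ K₂ : ℕ} {C : Matrix (Agent K₁ K₂) (Agent K₁ K₂) ℝ}
    (hC : IsLeftStochastic C) (hirr : C.toBlocks₁₁.IsIrreducible)
    (h : ∃ (k : Fin K₁) (l : Fin K₂), 0 < C (Sum.inr l) (Sum.inl k)) :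
    HasSmallPower C.toBlocks₁₁ := by
  have hcol : ∀ k, ∑ l, C.toBlocks₁₁ l k + ∑ l, C (Sum.inr l) (Sum.inl k) = 1 := fun k => by
    simpa [Fintype.sum_sum_type, toBlocks₁₁] using hC.2 (Sum.inl k)
  obtain ⟨k₀, l₀, hpos⟩ := h
  refine hasSmallPower_of_substochastic hirr (fun k => ?_) (k₀ := k₀) ?_
  · have := Finset.sum_nonneg fun (l : Fin K₂) (_ : l ∈ Finset.univ) => hC.1 (Sum.inr l) (Sum.inl k)
    linarith [hcol k]
  · have : 0 < ∑ l, C (Sum.inr l) (Sum.inl k₀) :=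
      Finset.sum_pos' (fun l _ => hC.1 _ _) ⟨l₀, Finset.mem_univ _, hpos⟩
    linarith [hcol k₀]

theorem IsStrongInference.sum_col {K₁ K₂ : ℕ} {C : Matrix (Agent K₁ K₂) (Agent K₁ K₂) ℝ}
    (hC : IsStrongInference C) (k : Agent K₁ K₂) : ∑ l, C l k = 1 := by
  obtain ⟨h₁, h₂, h₁₂, h₂₁⟩ := hC
  rcases k with k | k
  · have e : ∀ l, C (Sum.inl l) (Sum.inl k) = 0 := fun l => congrFun (congrFun h₁ l) k
    simpa [Fintype.sum_sum_type, e, toBlocks₂₁] using h₂₁.2 k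
  · have e : ∀ l, C (Sum.inr l) (Sum.inr k) = 0 := fun l => congrFun (congrFun h₂ l) k
    simpa [Fintype.sum_sum_type, e, toBlocks₁₂] using h₁₂.2 k

theorem lemma1 {K₁ K₂ : ℕ} (A₁ : Matrix (Fin K₁) (Fin K₁) ℝ) (A₂ : Matrix (Fin K₂) (Fin K₂) ℝ)
    (C : Matrix (Agent K₁ K₂) (Agent K₁ K₂) ℝ) (p₁ : Fin K₁ → ℝ) (p₂ : Fin K₂ → ℝ)
    (hA₁ : IsCombinationMatrix A₁) (hA₂ : IsCombinationMatrix A₂)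
    (hp₁ : IsPerronVector A₁ p₁) (hp₂ : IsPerronVector A₂ p₂) :
    -- ATC-ITC, weak cross-team subgraph, zero-sum objectives
    (IsWeakInference C →
      ∃ α : ℝ, 0 < α ∧ α < 1 ∧
        ∀ Lf : ℝ, ∃ μ₀ : ℝ, 0 < μ₀ ∧ ∀ G σ D κ : ℝ, 0 < κ → ∃ B : ℝ,
          ∀ (M₁ M₂ : ℕ) (J : Agent K₁ K₂ → Strategy M₁ → Strategy M₂ → ℝ),
            IsZeroSum p₁ p₂ J → LipschitzGradients J Lf → BoundedDisagreement p₁ p₂ J G →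
          ∀ (Ω : Type*) [MeasurableSpace Ω] (P : Measure Ω) [IsProbabilityMeasure P]
            (S : StochasticGradients Ω K₁ K₂ M₁ M₂) (z₀ : Ω → Profile K₁ K₂ M₁ M₂) (μ : ℝ),
            0 < μ → μ ≤ μ₀ →
            SquareIntegrableInit P z₀ → ∫ ω, deviation p₁ p₂ (z₀ ω) ∂P ≤ D →
            GradientNoise P J S (iterates (atcItcStep A₁ A₂ C μ) S z₀) σ →
          ∀ i : ℕ, Real.log (κ * μ ^ 2) / Real.log α ≤ i →
            Integrable
              (fun ω => deviation p₁ p₂ (iterates (atcItcStep A₁ A₂ C μ) S z₀ (i + 1) ω)) P ∧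
            ∫ ω, deviation p₁ p₂ (iterates (atcItcStep A₁ A₂ C μ) S z₀ (i + 1) ω) ∂P
              ≤ B * μ ^ 2) ∧
    -- ATC-C, strong cross-team subgraph, general objectives
    (IsStrongInference C →
      ∃ β : ℝ, 0 < β ∧ β < 1 ∧
        ∀ Lf : ℝ, ∃ μ₀ : ℝ, 0 < μ₀ ∧ ∀ G σ D κ : ℝ, 0 < κ → ∃ B : ℝ,
          ∀ (M₁ M₂ : ℕ) (J : Agent K₁ K₂ → Strategy M₁ → Strategy M₂ → ℝ),
            LipschitzGradients J Lf → BoundedDisagreement p₁ p₂ J G →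
          ∀ (Ω : Type*) [MeasurableSpace Ω] (P : Measure Ω) [IsProbabilityMeasure P]
            (S : StochasticGradients Ω K₁ K₂ M₁ M₂) (z₀ : Ω → Profile K₁ K₂ M₁ M₂) (μ : ℝ),
            0 < μ → μ ≤ μ₀ →
            SquareIntegrableInit P z₀ → ∫ ω, deviation p₁ p₂ (z₀ ω) ∂P ≤ D →
            GradientNoise P J S (iterates (atcCStep A₁ A₂ C μ) S z₀) σ →
          ∀ i : ℕ, Real.log (κ * μ ^ 2) / Real.log β ≤ i →
            Integrable
              (fun ω => deviation p₁ p₂ (iterates (atcCStep A₁ A₂ C μ) S z₀ (i + 1) ω)) P ∧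
            ∫ ω, deviation p₁ p₂ (iterates (atcCStep A₁ A₂ C μ) S z₀ (i + 1) ω) ∂P
              ≤ B * μ ^ 2) := by
  constructor
  · rintro ⟨hC, h₁, h₂, h₁₂, h₂₁⟩
    obtain ⟨α, hα0, hα1, H⟩ := consensus_atcItc hA₁ hA₂ hp₁ hp₂ hC.2
      (hasSmallPower_toBlocks₁₁ hC h₁ h₁₂) (hasSmallPower_toBlocks₂₂ hC h₂ h₂₁)
    refine ⟨α, hα0, hα1, fun Lf => ?_⟩
    obtain ⟨μ₀, hμ₀, H⟩ := H Lf
    refine ⟨μ₀, hμ₀, fun G σ D κ hκ => ?_⟩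
    obtain ⟨B, H⟩ := H G σ D κ hκ
    exact ⟨B, fun M₁ M₂ J hJ => H M₁ M₂ J (Or.inl hJ)⟩
  · intro hC
    obtain ⟨β, hβ0, hβ1, H⟩ := consensus_atcItc hA₁ hA₂ hp₁ hp₂ hC.sum_col
      (by rw [hC.1]; exact hasSmallPower_zero) (by rw [hC.2.1]; exact hasSmallPower_zero)
    refine ⟨β, hβ0, hβ1, fun Lf => ?_⟩
    obtain ⟨μ₀, hμ₀, H⟩ := H Lf
    refine ⟨μ₀, hμ₀, fun G σ D κ hκ => ?_⟩
    obtain ⟨B, H⟩ := H G σ D κ hκ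
    refine ⟨B, fun M₁ M₂ J => ?_⟩
    simp only [atcCStep_eq_atcItcStep hC.1 hC.2.1]
    exact H M₁ M₂ J (Or.inr ⟨hC.1, hC.2.1⟩)
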